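/- **The Laplace integral.** For a continuous $U\colon[a,b]\to\mathbb R$, the lower right and lower left Laplace derivates of $U$ at $x$ are $$\liminf_{s\to\infty}s^2\int_0^\delta e^{-st}[U(x+t)-U(x)]\,dt,\qquad \liminf_{s\to\infty}\,(-s^2)\int_0^\delta e^{-st}[U(x-t)-U(x)]\,dt,$$ where $\delta>0$ is so small that only points of $[a,b]$ occur (the values do not depend on $\delta$); the upper derivates are defined with $\limsup$. Let $f$ be a real-valued function. A *major function* of $f$ on $[a,b]$ is a continuous $U\colon[a,b]\to\mathbb R$ with $U(a)=0$ whose lower right derivate (at each $x\in[a,b)$) and lower left derivate (at each $x\in(a,b]$) are $\ge f(x)$. A *minor function* is a continuous $V$ with $V(a)=0$ whose upper derivates are $\le f(x)$ at these points. $f$ is *Laplace integrable* on $[a,b]$ if for every $\varepsilon>0$ there are a major function $U$ and a minor function $V$ with $U(b)-V(b)\le\varepsilon$; then $\int_a^bf:=\inf_UU(b)=\sup_VV(b)$. $f$ is Laplace integrable on $[a,\infty)$ if it is so on $[a,c]$ for all $c\ge a$ and $\int_a^\infty f:=\lim_{c\to\infty}\int_a^cf$ exists in $\mathbb R$; likewise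 on $(-\infty,b]$. $f\in\mathcal{LP}(\mathbb R)$ means that for some $a\in\mathbb R$ it is Laplace integrable on $(-\infty,a]$ and on $[a,\infty)$; then $\int_{-\infty}^\infty f:=\int_{-\infty}^af+\int_a^\infty f$. All integrals of $f$ and all iterated integrals below are Laplace integrals. Write $(f*G)(x)=\int_{-\infty}^\infty f(x-y)G(y)\,dy$, $\|f\|_{\mathcal A}=\sup_{x\in\mathbb R}\left|\int_{-\infty}^xf\right|$ (Alexiewicz norm), and $\|\cdot\|_1$ for the $L^1(\mathbb R)$ norm. **Theorem.** Let $f\colon\mathbb R\to\mathbb R$ belong to $\mathcal{LP}(\mathbb R)$, let $g\colon\mathbb R\to\mathbb R$ be Lebesgue integrable and of bounded variation on $\mathbb R$, and let $F(x)=\int_{-\infty}^xf$ and $G(x)=\int_{-\infty}^xg$ for $x\in\mathbb R$ (the latter a Lebesgue integral). Suppose that $F$ and $G$ are Lebesgue integrable on $\mathbb R$ and that $\lim_{x\to\infty}G(x)=0$. Then $(f*G)(x)$ exists for every $x\in\mathbb R$, and for every $t\in(-\infty,\infty]$ both sides of $$\int_{-\infty}^{t}\int_{-\infty}^{\infty}f(x-y)G(y)\,dy\,dx=\int_{-\infty}^{\infty}\int_{-\infty}^{t}f(x-y)G(y)\,dx\,dy$$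 exist (including the inner integrals, for every value of the outer variable) and they are equal. Moreover $f*G$ is Lebesgue integrable and Laplace integrable on $\mathbb R$, $\|f\|_{\mathcal A}<\infty$, and $$\|f*G\|_1\le\|F\|_1\|g\|_1,\qquad\|f*G\|_{\mathcal A}\le\|f\|_{\mathcal A}\|G\|_1 .$$ -/

import Mathlib

open Filter Topology MeasureTheory Set

/-- `s² ∫₀^δ e^{-st} (U(x+t) - U(x)) dt`, whose behaviour as `s → ∞` gives the right Laplace
derivates of `U` at `x`. -/
noncomputable def laplaceQuotRight (U : ℝ → ℝ) (x δ s : ℝ) : ℝ :=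
  s ^ 2 * ∫ t in (0 : ℝ)..δ, Real.exp (-(s * t)) * (U (x + t) - U x)

/-- `-s² ∫₀^δ e^{-st} (U(x-t) - U(x)) dt`, whose behaviour as `s → ∞` gives the left Laplace
derivates of `U` at `x`. -/
noncomputable def laplaceQuotLeft (U : ℝ → ℝ) (x δ s : ℝ) : ℝ :=
  -s ^ 2 * ∫ t in (0 : ℝ)..δ, Real.exp (-(s * t)) * (U (x - t) - U x)

/-- Lower right Laplace derivate (for continuous `U` it does not depend on `δ > 0`). -/
noncomputable def lowerLaplaceRight (U : ℝ → ℝ) (x δ : ℝ) : EReal :=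
  liminf (fun s : ℝ => (laplaceQuotRight U x δ s : EReal)) atTop

/-- Upper right Laplace derivate. -/
noncomputable def upperLaplaceRight (U : ℝ → ℝ) (x δ : ℝ) : EReal :=
  limsup (fun s : ℝ => (laplaceQuotRight U x δ s : EReal)) atTop

/-- Lower left Laplace derivate. -/
noncomputable def lowerLaplaceLeft (U : ℝ → ℝ) (x δ : ℝ) : EReal :=
  liminf (fun s : ℝ => (laplaceQuotLeft U x δ s : EReal)) atTop

/-- Upper left Laplace derivate. -/
noncomputable def upperLaplaceLeft (U : ℝ → ℝ) (x δ : ℝ) : EReal :=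
  limsup (fun s : ℝ => (laplaceQuotLeft U x δ s : EReal)) atTop

/-- `U` is a (continuous, normalized) major function of `f` on `[a, b]`: its lower Laplace derivate
is at least `f` at every point of `[a, b]` (one-sided at the end points). As `f` is real-valued, the
lower derivate is then automatically `> -∞` everywhere. -/
structure IsLaplaceMajor (f : ℝ → ℝ) (a b : ℝ) (U : ℝ → ℝ) : Prop where
  continuousOn : ContinuousOn U (Icc a b)
  left_eq_zero : U a = 0
  right_ge : ∀ x ∈ Ico a b, ∃ δ > 0, x + δ ≤ b ∧ (f x : EReal) ≤ lowerLaplaceRight U x δ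
  left_ge : ∀ x ∈ Ioc a b, ∃ δ > 0, a ≤ x - δ ∧ (f x : EReal) ≤ lowerLaplaceLeft U x δ

/-- `V` is a (continuous, normalized) minor function of `f` on `[a, b]`: its upper Laplace derivate
is at most `f` at every point of `[a, b]` (one-sided at the end points). -/
structure IsLaplaceMinor (f : ℝ → ℝ) (a b : ℝ) (V : ℝ → ℝ) : Prop where
  continuousOn : ContinuousOn V (Icc a b)
  left_eq_zero : V a = 0
  right_le : ∀ x ∈ Ico a b, ∃ δ > 0, x + δ ≤ b ∧ upperLaplaceRight V x δ ≤ (f x : EReal)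
  left_le : ∀ x ∈ Ioc a b, ∃ δ > 0, a ≤ x - δ ∧ upperLaplaceLeft V x δ ≤ (f x : EReal)

/-- `f` is Laplace integrable on the compact interval `[a, b]` (meant for `a ≤ b`). -/
def LaplaceIntegrableIcc (f : ℝ → ℝ) (a b : ℝ) : Prop :=
  ∀ ε > 0, ∃ U V : ℝ → ℝ, IsLaplaceMajor f a b U ∧ IsLaplaceMinor f a b V ∧ U b - V b ≤ ε

/-- The Laplace integral of `f` over `[a, b]`: the infimum of `U(b)` over the major functions `U`
(for integrable `f`, also the supremum of `V(b)` over the minor functions `V`). -/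
noncomputable def laplaceIntegralIcc (f : ℝ → ℝ) (a b : ℝ) : ℝ :=
  sInf {r : ℝ | ∃ U : ℝ → ℝ, IsLaplaceMajor f a b U ∧ U b = r}

/-- `f` is Laplace integrable on `[a, ∞)`. -/
def LaplaceIntegrableIci (f : ℝ → ℝ) (a : ℝ) : Prop :=
  (∀ c, a ≤ c → LaplaceIntegrableIcc f a c) ∧
    ∃ L : ℝ, Tendsto (fun c => laplaceIntegralIcc f a c) atTop (𝓝 L)

/-- `∫_a^∞ f`. -/
noncomputable def laplaceIntegralIci (f : ℝ → ℝ) (a : ℝ) : ℝ :=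
  limUnder atTop (fun c => laplaceIntegralIcc f a c)

/-- `f` is Laplace integrable on `(-∞, b]`. -/
def LaplaceIntegrableIic (f : ℝ → ℝ) (b : ℝ) : Prop :=
  (∀ c, c ≤ b → LaplaceIntegrableIcc f c b) ∧
    ∃ L : ℝ, Tendsto (fun c => laplaceIntegralIcc f c b) atBot (𝓝 L)

/-- `∫_{-∞}^b f`. -/
noncomputable def laplaceIntegralIic (f : ℝ → ℝ) (b : ℝ) : ℝ :=
  limUnder atBot (fun c => laplaceIntegralIcc f c b)

/-- `f ∈ LP(ℝ)`: for some `a`, `f` is Laplace integrable on `(-∞, a]` and on `[a, ∞)`. -/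
def LaplaceIntegrable (f : ℝ → ℝ) : Prop :=
  ∃ a : ℝ, LaplaceIntegrableIic f a ∧ LaplaceIntegrableIci f a

open Classical in
/-- `∫_{-∞}^∞ f = ∫_{-∞}^a f + ∫_a^∞ f`, where `a` is a point as in the definition of `LP(ℝ)`. -/
noncomputable def laplaceIntegral (f : ℝ → ℝ) : ℝ :=
  if h : LaplaceIntegrable f then
    laplaceIntegralIic f h.choose + laplaceIntegralIci f h.choose
  else 0

/-- The convolution `(f * g)(x) = ∫_{-∞}^∞ f(x - y) g(y) dy`, as a Laplace integral. -/
noncomputable def laplaceConv (f g : ℝ → ℝ) (x : ℝ) : ℝ :=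
  laplaceIntegral (fun y => f (x - y) * g y)

/-- The Alexiewicz norm `sup_x |∫_{-∞}^x f|`, as an extended nonnegative real. -/
noncomputable def alexiewiczNorm (f : ℝ → ℝ) : ENNReal :=
  ⨆ x : ℝ, ENNReal.ofReal |laplaceIntegralIic f x|

/-! ### One-sided Laplace derivates -/

theorem coe_le_liminf_coe_iff {q : ℝ → ℝ} {r : ℝ} :
    (r : EReal) ≤ liminf (fun s => (q s : EReal)) atTop ↔
      ∀ ε > 0, ∀ᶠ s in atTop, r - ε ≤ q s := by
  rw [le_liminf_iff]
  constructor
  · intro h ε hε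
    filter_upwards [h ((r - ε : ℝ) : EReal) (by exact_mod_cast sub_lt_self r hε)] with s hs
    exact (EReal.coe_lt_coe_iff.1 hs).le
  · intro h y hy
    obtain ⟨z, hyz, hzr⟩ := EReal.lt_iff_exists_real_btwn.1 hy
    have hzr' : z < r := by exact_mod_cast hzr
    filter_upwards [h (r - z) (sub_pos.2 hzr')] with s hs
    refine hyz.trans_le ?_
    exact_mod_cast (by linarith : z ≤ q s)

theorem limsup_coe_le_coe_iff {q : ℝ → ℝ} {r : ℝ} :
    limsup (fun s => (q s : EReal)) atTop ≤ (r : EReal) ↔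
      ∀ ε > 0, ∀ᶠ s in atTop, q s ≤ r + ε := by
  rw [limsup_le_iff]
  constructor
  · intro h ε hε
    filter_upwards [h ((r + ε : ℝ) : EReal) (by exact_mod_cast lt_add_of_pos_right r hε)] with s hs
    exact (EReal.coe_lt_coe_iff.1 hs).le
  · intro h y hy
    obtain ⟨z, hrz, hzy⟩ := EReal.lt_iff_exists_real_btwn.1 hy
    have hrz' : r < z := by exact_mod_cast hrz
    filter_upwards [h (z - r) (sub_pos.2 hrz')] with s hs
    refine lt_of_le_of_lt ?_ hzy
    exact_mod_cast (by linarith : q s ≤ z)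

theorem coe_le_lowerLaplaceRight_iff {U : ℝ → ℝ} {x δ r : ℝ} :
    (r : EReal) ≤ lowerLaplaceRight U x δ ↔
      ∀ ε > 0, ∀ᶠ s in atTop, r - ε ≤ laplaceQuotRight U x δ s :=
  coe_le_liminf_coe_iff

theorem laplaceQuotRight_neg (U : ℝ → ℝ) (x δ s : ℝ) :
    laplaceQuotRight (fun y => -U y) x δ s = -laplaceQuotRight U x δ s := by
  simp only [laplaceQuotRight]
  rw [← mul_neg, ← intervalIntegral.integral_neg]
  congr 2
  ext t
  ring

theorem laplaceQuotLeft_neg (U : ℝ → ℝ) (x δ s : ℝ) :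
    laplaceQuotLeft (fun y => -U y) x δ s = -laplaceQuotLeft U x δ s := by
  simp only [laplaceQuotLeft]
  rw [← mul_neg, ← intervalIntegral.integral_neg]
  congr 2
  ext t
  ring

theorem upperLaplaceRight_le_coe_iff {V : ℝ → ℝ} {x δ r : ℝ} :
    upperLaplaceRight V x δ ≤ (r : EReal) ↔
      ((-r : ℝ) : EReal) ≤ lowerLaplaceRight (fun y => -V y) x δ := by
  rw [upperLaplaceRight, lowerLaplaceRight, limsup_coe_le_coe_iff, coe_le_liminf_coe_iff]
  simp only [laplaceQuotRight_neg]
  refine forall₂_congr fun ε _ => eventually_congr (Eventually.of_forall fun s => ?_)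
  constructor <;> intro h <;> linarith

theorem upperLaplaceLeft_le_coe_iff {V : ℝ → ℝ} {x δ r : ℝ} :
    upperLaplaceLeft V x δ ≤ (r : EReal) ↔
      ((-r : ℝ) : EReal) ≤ lowerLaplaceLeft (fun y => -V y) x δ := by
  rw [upperLaplaceLeft, lowerLaplaceLeft, limsup_coe_le_coe_iff, coe_le_liminf_coe_iff]
  simp only [laplaceQuotLeft_neg]
  refine forall₂_congr fun ε _ => eventually_congr (Eventually.of_forall fun s => ?_)
  constructor <;> intro h <;> linarith

/-- Reflecting the graph of `U` in a point exchanges left and right Laplace derivates. -/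
theorem lowerLaplaceRight_reflect (U : ℝ → ℝ) (k c x δ : ℝ) :
    lowerLaplaceRight (fun y => k - U (c - y)) x δ = lowerLaplaceLeft U (c - x) δ := by
  simp only [lowerLaplaceRight, lowerLaplaceLeft, laplaceQuotRight, laplaceQuotLeft]
  congr 1
  ext s
  rw [neg_mul, ← mul_neg, ← intervalIntegral.integral_neg]
  congr 3
  ext t
  rw [show c - (x + t) = c - x - t by ring]
  ring

theorem lowerLaplaceLeft_reflect (U : ℝ → ℝ) (k c x δ : ℝ) :
    lowerLaplaceLeft (fun y => k - U (c - y)) x δ = lowerLaplaceRight U (c - x) δ := by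
  simp only [lowerLaplaceRight, lowerLaplaceLeft, laplaceQuotRight, laplaceQuotLeft]
  congr 1
  ext s
  rw [neg_mul, ← mul_neg, ← intervalIntegral.integral_neg]
  congr 3
  ext t
  rw [show c - (x - t) = c - x + t by ring]
  ring

theorem lowerLaplaceRight_congr {U W : ℝ → ℝ} {x δ : ℝ} (hδ : 0 < δ)
    (h : EqOn U W (Icc x (x + δ))) : lowerLaplaceRight U x δ = lowerLaplaceRight W x δ := by
  simp only [lowerLaplaceRight, laplaceQuotRight]
  congr 1
  ext s
  congr 2
  refine intervalIntegral.integral_congr fun t ht => ?_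
  rw [uIcc_of_le hδ.le] at ht
  rw [h ⟨by linarith [ht.1], by linarith [ht.2]⟩, h ⟨le_rfl, by linarith⟩]

theorem intervalIntegrable_laplace {U : ℝ → ℝ} {x δ : ℝ} (hδ : 0 ≤ δ)
    (hU : ContinuousOn U (Icc x (x + δ))) (s : ℝ) :
    IntervalIntegrable (fun t => Real.exp (-(s * t)) * (U (x + t) - U x)) volume 0 δ := by
  refine ContinuousOn.intervalIntegrable ?_
  rw [uIcc_of_le hδ]
  refine ContinuousOn.mul (by fun_prop) (ContinuousOn.sub ?_ continuousOn_const)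
  exact hU.comp (by fun_prop) fun t ht => ⟨by linarith [ht.1], by linarith [ht.2]⟩

theorem integral_sq_mul_exp_mul_id (s δ : ℝ) :
    ∫ t in (0 : ℝ)..δ, s ^ 2 * (Real.exp (-(s * t)) * t) =
      1 - (1 + s * δ) * Real.exp (-(s * δ)) := by
  have h : ∀ t ∈ uIcc 0 δ, HasDerivAt (fun t => -(1 + s * t) * Real.exp (-(s * t)))
      (s ^ 2 * (Real.exp (-(s * t)) * t)) t := by
    intro t _
    have h1 : HasDerivAt (fun t : ℝ => -(1 + s * t)) (-s) t := by
      simpa using (((hasDerivAt_id' t).const_mul s).const_add 1).fun_neg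
    have h2 : HasDerivAt (fun t : ℝ => -(s * t)) (-s) t := by
      simpa using ((hasDerivAt_id' t).const_mul s).fun_neg
    refine (h1.mul h2.exp).congr_deriv ?_
    ring
  rw [intervalIntegral.integral_eq_sub_of_hasDerivAt h
    (Continuous.intervalIntegrable (by fun_prop) _ _)]
  simp
  ring

theorem integral_sq_mul_exp_mul_sq_le {s δ : ℝ} (hs : 0 < s) (hδ : 0 ≤ δ) :
    ∫ t in (0 : ℝ)..δ, s ^ 2 * (Real.exp (-(s * t)) * t ^ 2) ≤ 2 / s := by
  have h : ∀ t ∈ uIcc 0 δ, HasDerivAt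
      (fun t => -(s * t ^ 2 + 2 * t + 2 / s) * Real.exp (-(s * t)))
      (s ^ 2 * (Real.exp (-(s * t)) * t ^ 2)) t := by
    intro t _
    have h1 : HasDerivAt (fun t : ℝ => -(s * t ^ 2 + 2 * t + 2 / s)) (-(s * (2 * t) + 2)) t := by
      refine ((((hasDerivAt_pow 2 t).const_mul s).add
        ((hasDerivAt_id' t).const_mul 2)).add_const (2 / s)).fun_neg.congr_deriv ?_
      simp
    have h2 : HasDerivAt (fun t : ℝ => -(s * t)) (-s) t := by
      simpa using ((hasDerivAt_id' t).const_mul s).fun_neg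
    refine (h1.mul h2.exp).congr_deriv ?_
    field_simp
    ring
  rw [intervalIntegral.integral_eq_sub_of_hasDerivAt h
    (Continuous.intervalIntegrable (by fun_prop) _ _)]
  have : 0 ≤ (s * δ ^ 2 + 2 * δ + 2 / s) * Real.exp (-(s * δ)) := by positivity
  simp
  linarith

/-- If `R` has a right derivative at `x`, its right Laplace quotients converge to it. -/
theorem tendsto_laplaceQuotRight {R : ℝ → ℝ} {x m δ : ℝ} (hδ : 0 < δ)
    (hc : ContinuousOn R (Icc x (x + δ))) (hd : HasDerivWithinAt R m (Icc x (x + δ)) x) :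
    Tendsto (laplaceQuotRight R x δ) atTop (𝓝 m) := by
  set D : ℝ → ℝ := fun t => R (x + t) - R x - m * t with hD
  have hDc : ContinuousOn D (Icc 0 δ) := by
    refine ((hc.comp (by fun_prop) fun t ht => ?_).sub continuousOn_const).sub (by fun_prop)
    exact ⟨by linarith [ht.1], by linarith [ht.2]⟩
  obtain ⟨B, hB⟩ := isCompact_Icc.exists_bound_of_continuousOn hDc
  have hB0 : 0 ≤ B := (norm_nonneg _).trans (hB 0 ⟨le_rfl, hδ.le⟩)
  have key : ∀ s, laplaceQuotRight R x δ s =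
      (∫ t in (0 : ℝ)..δ, s ^ 2 * (Real.exp (-(s * t)) * D t)) +
        m * (1 - (1 + s * δ) * Real.exp (-(s * δ))) := by
    intro s
    have h1 : IntervalIntegrable (fun t => s ^ 2 * (Real.exp (-(s * t)) * D t)) volume 0 δ := by
      refine ContinuousOn.intervalIntegrable ?_
      rw [uIcc_of_le hδ.le]
      exact ContinuousOn.mul continuousOn_const (ContinuousOn.mul (by fun_prop) hDc)
    have h2 : IntervalIntegrable (fun t => m * (s ^ 2 * (Real.exp (-(s * t)) * t)))
        volume 0 δ := Continuous.intervalIntegrable (by fun_prop) _ _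
    rw [← integral_sq_mul_exp_mul_id, ← intervalIntegral.integral_const_mul,
      ← intervalIntegral.integral_add h1 h2, laplaceQuotRight,
      ← intervalIntegral.integral_const_mul]
    congr 1
    ext t
    simp only [hD]
    ring
  have hexp : Tendsto (fun s : ℝ => (1 + s * δ) * Real.exp (-(s * δ))) atTop (𝓝 0) := by
    have h0 : Tendsto (fun s : ℝ => s * δ) atTop atTop := tendsto_id.atTop_mul_const hδ
    have h1 : Tendsto (fun u : ℝ => u ^ 0 * Real.exp (-u) + u ^ 1 * Real.exp (-u)) atTop
        (𝓝 (0 + 0)) :=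
      (Real.tendsto_pow_mul_exp_neg_atTop_nhds_zero 0).add
        (Real.tendsto_pow_mul_exp_neg_atTop_nhds_zero 1)
    refine ((h1.comp h0).congr fun s => ?_).trans (by simp)
    simp only [Function.comp]
    ring
  have hmain : Tendsto (fun s => ∫ t in (0 : ℝ)..δ, s ^ 2 * (Real.exp (-(s * t)) * D t))
      atTop (𝓝 0) := by
    rw [Metric.tendsto_nhds]
    intro ε hε
    have hlo := (hasDerivWithinAt_iff_isLittleO.1 hd)
    rw [Asymptotics.isLittleO_iff] at hlo
    have h2 := hlo (half_pos hε)
    rw [eventually_nhdsWithin_iff, Metric.eventually_nhds_iff] at h2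
    obtain ⟨η, hη, hηD⟩ := h2
    have hbound : ∀ t ∈ Icc 0 δ, |D t| ≤ ε / 2 * t + B / η ^ 2 * t ^ 2 := by
      intro t ht
      by_cases htη : t < η
      · have := hηD (y := x + t) (by simpa [abs_of_nonneg ht.1] using htη)
          ⟨by linarith [ht.1], by linarith [ht.2]⟩
        simp only [add_sub_cancel_left, smul_eq_mul, Real.norm_eq_abs, abs_of_nonneg ht.1] at this
        have h3 : |D t| ≤ ε / 2 * t := by rwa [mul_comm t m] at this
        have : 0 ≤ B / η ^ 2 * t ^ 2 := by positivity
        linarith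
      · have h3 : |D t| ≤ B := hB t ht
        have h4 : B ≤ B / η ^ 2 * t ^ 2 := by
          rw [div_mul_eq_mul_div, le_div_iff₀ (by positivity)]
          have : η ≤ t := not_lt.1 htη
          gcongr
        have : 0 ≤ ε / 2 * t := mul_nonneg (by linarith) ht.1
        linarith
    have hlim : Tendsto (fun s : ℝ => B / η ^ 2 * (2 / s)) atTop (𝓝 0) := by
      simpa using (tendsto_const_nhds (x := (2 : ℝ))).div_atTop tendsto_id |>.const_mul (B / η ^ 2)
    filter_upwards [eventually_gt_atTop 0, hlim.eventually_lt_const (half_pos hε)] with s hs hs2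
    rw [dist_zero_right]
    have hle : ‖∫ t in (0 : ℝ)..δ, s ^ 2 * (Real.exp (-(s * t)) * D t)‖ ≤
        ∫ t in (0 : ℝ)..δ, (ε / 2 * (s ^ 2 * (Real.exp (-(s * t)) * t)) +
          B / η ^ 2 * (s ^ 2 * (Real.exp (-(s * t)) * t ^ 2))) := by
      refine intervalIntegral.norm_integral_le_of_norm_le hδ.le (Eventually.of_forall fun t ht => ?_)
        (Continuous.intervalIntegrable (by fun_prop) _ _)
      have h5 := hbound t ⟨ht.1.le, ht.2⟩
      rw [norm_mul, norm_mul, Real.norm_eq_abs, Real.norm_eq_abs, Real.norm_eq_abs,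
        abs_of_nonneg (sq_nonneg s), Real.abs_exp]
      calc s ^ 2 * (Real.exp (-(s * t)) * |D t|)
          ≤ s ^ 2 * (Real.exp (-(s * t)) * (ε / 2 * t + B / η ^ 2 * t ^ 2)) := by gcongr
        _ = _ := by ring
    have h8 : ∀ c : ℝ, ∀ v : ℝ → ℝ, ∫ t in (0 : ℝ)..δ, c * v t = c * ∫ t in (0 : ℝ)..δ, v t :=
      fun c v => intervalIntegral.integral_const_mul c v
    rw [intervalIntegral.integral_add (Continuous.intervalIntegrable (by fun_prop) _ _)
      (Continuous.intervalIntegrable (by fun_prop) _ _), h8 (ε / 2), h8 (B / η ^ 2),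
      integral_sq_mul_exp_mul_id] at hle
    have h6 : B / η ^ 2 * (∫ t in (0 : ℝ)..δ, s ^ 2 * (Real.exp (-(s * t)) * t ^ 2)) ≤
        B / η ^ 2 * (2 / s) := by
      have := integral_sq_mul_exp_mul_sq_le hs hδ.le
      gcongr
    have h7 : 0 ≤ (1 + s * δ) * Real.exp (-(s * δ)) := by positivity
    nlinarith
  have := hmain.add ((tendsto_const_nhds (x := (1 : ℝ)).sub hexp).const_mul m)
  simp only [sub_zero, mul_one, zero_add] at this
  exact this.congr fun s => (key s).symm

/-- Lower right Laplace derivates of `k U + R` where `k ≥ 0` and `R` is differentiable at `x`. -/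
theorem le_lowerLaplaceRight_of_eqOn {U R H : ℝ → ℝ} {x r m k δ : ℝ} (hδ : 0 < δ) (hk : 0 ≤ k)
    (hU : ContinuousOn U (Icc x (x + δ))) (hUr : (r : EReal) ≤ lowerLaplaceRight U x δ)
    (hR : ContinuousOn R (Icc x (x + δ))) (hd : HasDerivWithinAt R m (Icc x (x + δ)) x)
    (hH : EqOn H (fun y => k * U y + R y) (Icc x (x + δ))) :
    ((k * r + m : ℝ) : EReal) ≤ lowerLaplaceRight H x δ := by
  rw [lowerLaplaceRight_congr hδ hH]
  rw [coe_le_lowerLaplaceRight_iff] at hUr ⊢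
  intro ε hε
  have hk1 : 0 < k + 1 := by linarith
  filter_upwards [hUr (ε / 2 / (k + 1)) (by positivity),
    (tendsto_laplaceQuotRight hδ hR hd).eventually_const_lt
      (show m - ε / 2 < m by linarith)] with s h1 h2
  have h3 : laplaceQuotRight (fun y => k * U y + R y) x δ s =
      k * laplaceQuotRight U x δ s + laplaceQuotRight R x δ s := by
    simp only [laplaceQuotRight]
    rw [mul_left_comm, ← mul_add, ← intervalIntegral.integral_const_mul k,
      ← intervalIntegral.integral_add ((intervalIntegrable_laplace hδ.le hU s).const_mul k)
        (intervalIntegrable_laplace hδ.le hR s)]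
    congr 2
    ext t
    ring
  have h4 := mul_le_mul_of_nonneg_left h1 hk
  have h5 : k * (ε / 2 / (k + 1)) ≤ ε / 2 := by
    rw [mul_div_assoc', div_le_iff₀ hk1]
    nlinarith
  rw [h3]
  linarith

theorem le_lowerLaplaceLeft_of_eqOn {U R H : ℝ → ℝ} {x r m k δ : ℝ} (hδ : 0 < δ) (hk : 0 ≤ k)
    (hU : ContinuousOn U (Icc (x - δ) x)) (hUr : (r : EReal) ≤ lowerLaplaceLeft U x δ)
    (hR : ContinuousOn R (Icc (x - δ) x)) (hd : HasDerivWithinAt R m (Icc (x - δ) x) x)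
    (hH : EqOn H (fun y => k * U y + R y) (Icc (x - δ) x)) :
    ((k * r + m : ℝ) : EReal) ≤ lowerLaplaceLeft H x δ := by
  have hmaps : MapsTo (fun y : ℝ => 0 - y) (Icc (-x) (-x + δ)) (Icc (x - δ) x) :=
    fun y hy => ⟨by linarith [hy.2], by linarith [hy.1]⟩
  have e : x = 0 - -x := by ring
  rw [e, ← lowerLaplaceRight_reflect _ 0] at hUr ⊢
  refine le_lowerLaplaceRight_of_eqOn (R := fun y => 0 - R (0 - y)) hδ hk
    (continuousOn_const.sub (hU.comp (by fun_prop) hmaps)) hUr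
    (continuousOn_const.sub (hR.comp (by fun_prop) hmaps)) ?_ fun y hy => ?_
  · have h1 : HasDerivWithinAt (fun y : ℝ => 0 - y) (-1) (Icc (-x) (-x + δ)) (-x) := by
      simpa using (hasDerivAt_id' (-x)).fun_neg.hasDerivWithinAt
    have h2 : HasDerivWithinAt R m (Icc (x - δ) x) (0 - -x) := by rwa [← e]
    simpa using (h2.comp (-x) h1 hmaps).const_sub 0
  · have := hH (hmaps hy)
    simp only [Pi.sub_apply, Function.comp] at this ⊢
    rw [this]
    ring

theorem lowerLaplaceRight_add_le {U W : ℝ → ℝ} {x r q δ : ℝ} (hδ : 0 < δ)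
    (hU : ContinuousOn U (Icc x (x + δ))) (hUr : (r : EReal) ≤ lowerLaplaceRight U x δ)
    (hW : ContinuousOn W (Icc x (x + δ))) (hWq : (q : EReal) ≤ lowerLaplaceRight W x δ) :
    ((r + q : ℝ) : EReal) ≤ lowerLaplaceRight (fun y => U y + W y) x δ := by
  rw [coe_le_lowerLaplaceRight_iff] at *
  intro ε hε
  filter_upwards [hUr (ε / 2) (half_pos hε), hWq (ε / 2) (half_pos hε)] with s h1 h2
  have h3 : laplaceQuotRight (fun y => U y + W y) x δ s =
      laplaceQuotRight U x δ s + laplaceQuotRight W x δ s := by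
    simp only [laplaceQuotRight]
    rw [← mul_add, ← intervalIntegral.integral_add (intervalIntegrable_laplace hδ.le hU s)
        (intervalIntegrable_laplace hδ.le hW s)]
    congr 2
    ext t
    ring
  rw [h3]
  linarith

/-- The lower right Laplace derivate of a continuous function does not depend on `δ`. -/
theorem le_lowerLaplaceRight_of_le {U : ℝ → ℝ} {x r δ δ' : ℝ} (hδ' : 0 < δ') (h : δ' ≤ δ)
    (hU : ContinuousOn U (Icc x (x + δ))) (hUr : (r : EReal) ≤ lowerLaplaceRight U x δ) :
    (r : EReal) ≤ lowerLaplaceRight U x δ' := by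
  rw [coe_le_lowerLaplaceRight_iff] at *
  intro ε hε
  have hc : ContinuousOn (fun t => U (x + t) - U x) (Icc 0 δ) :=
    (hU.comp (by fun_prop) fun t ht => ⟨by linarith [ht.1], by linarith [ht.2]⟩).sub
      continuousOn_const
  obtain ⟨B, hB⟩ := isCompact_Icc.exists_bound_of_continuousOn hc
  have hlim : Tendsto (fun s : ℝ => s ^ 2 * (Real.exp (-(s * δ')) * B * |δ - δ'|)) atTop
      (𝓝 0) := by
    have h0 : Tendsto (fun s : ℝ => s * δ') atTop atTop := tendsto_id.atTop_mul_const hδ'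
    have h1 := ((Real.tendsto_pow_mul_exp_neg_atTop_nhds_zero 2).comp h0).mul_const
      (B * |δ - δ'| / δ' ^ 2)
    rw [zero_mul] at h1
    refine h1.congr fun s => ?_
    simp only [Function.comp]
    field_simp
  filter_upwards [hUr (ε / 2) (half_pos hε), hlim.eventually_lt_const (half_pos hε),
    eventually_gt_atTop 0] with s h1 h2 hs
  have hi := intervalIntegrable_laplace (hδ'.le.trans h) hU s
  have hadd := intervalIntegral.integral_add_adjacent_intervals
    (hi.mono_set (c := 0) (d := δ') (by
      rw [uIcc_of_le hδ'.le, uIcc_of_le (hδ'.le.trans h)]; exact Icc_subset_Icc le_rfl h))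
    (hi.mono_set (c := δ') (d := δ) (by
      rw [uIcc_of_le h, uIcc_of_le (hδ'.le.trans h)]; exact Icc_subset_Icc hδ'.le le_rfl))
  have htail : ‖∫ t in δ'..δ, Real.exp (-(s * t)) * (U (x + t) - U x)‖ ≤
      Real.exp (-(s * δ')) * B * |δ - δ'| := by
    refine intervalIntegral.norm_integral_le_of_norm_le_const fun t ht => ?_
    rw [uIoc_of_le h] at ht
    rw [norm_mul, Real.norm_eq_abs, Real.abs_exp]
    have := hB t ⟨by linarith [ht.1], ht.2⟩
    have h3 : -(s * t) ≤ -(s * δ') := by nlinarith [ht.1]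
    gcongr
  have h4 := (le_abs_self _).trans htail
  have h5 := mul_le_mul_of_nonneg_left h4 (sq_nonneg s)
  rw [laplaceQuotRight, ← hadd, mul_add] at h1
  rw [laplaceQuotRight]
  linarith

theorem le_lowerLaplaceLeft_of_le {U : ℝ → ℝ} {x r δ δ' : ℝ} (hδ' : 0 < δ') (h : δ' ≤ δ)
    (hU : ContinuousOn U (Icc (x - δ) x)) (hUr : (r : EReal) ≤ lowerLaplaceLeft U x δ) :
    (r : EReal) ≤ lowerLaplaceLeft U x δ' := by
  have e : x = 0 - -x := by ring
  rw [e, ← lowerLaplaceRight_reflect _ 0] at hUr ⊢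
  refine le_lowerLaplaceRight_of_le hδ' h (continuousOn_const.sub (hU.comp (by fun_prop) ?_)) hUr
  exact fun y hy => ⟨by linarith [hy.2], by linarith [hy.1]⟩

theorem lowerLaplaceLeft_add_le {U W : ℝ → ℝ} {x r q δ : ℝ} (hδ : 0 < δ)
    (hU : ContinuousOn U (Icc (x - δ) x)) (hUr : (r : EReal) ≤ lowerLaplaceLeft U x δ)
    (hW : ContinuousOn W (Icc (x - δ) x)) (hWq : (q : EReal) ≤ lowerLaplaceLeft W x δ) :
    ((r + q : ℝ) : EReal) ≤ lowerLaplaceLeft (fun y => U y + W y) x δ := by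
  have hmaps : MapsTo (fun y : ℝ => 0 - y) (Icc (-x) (-x + δ)) (Icc (x - δ) x) :=
    fun y hy => ⟨by linarith [hy.2], by linarith [hy.1]⟩
  have e : x = 0 - -x := by ring
  rw [e, ← lowerLaplaceRight_reflect _ 0] at hUr hWq ⊢
  have := lowerLaplaceRight_add_le hδ (continuousOn_const.sub (hU.comp (by fun_prop) hmaps)) hUr
    (continuousOn_const.sub (hW.comp (by fun_prop) hmaps)) hWq
  convert this using 2
  ext y
  simp only [Pi.sub_apply, Function.comp]
  ring

/-- A continuous function with nonnegative lower right Laplace derivates does not decrease. -/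
theorem le_of_zero_le_lowerLaplaceRight {U : ℝ → ℝ} {a b : ℝ} (hab : a ≤ b)
    (hU : ContinuousOn U (Icc a b))
    (h : ∀ x ∈ Ico a b, ∃ δ > 0, x + δ ≤ b ∧ ((0 : ℝ) : EReal) ≤ lowerLaplaceRight U x δ) :
    U a ≤ U b := by
  rcases hab.eq_or_lt with rfl | hab'
  · exact le_rfl
  by_contra! hlt
  set η : ℝ := (U a - U b) / (b - a) with hη
  have hη0 : 0 < η := div_pos (by linarith) (by linarith)
  have hηe : η * (b - a) = U a - U b := div_mul_cancel₀ _ (by linarith)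
  set W : ℝ → ℝ := fun y => 1 * U y + η * y with hW
  have hWc : ContinuousOn W (Icc a b) := by
    exact (continuousOn_const.mul hU).add (by fun_prop)
  have hWab : W a = W b := by simp only [hW]; linarith
  obtain ⟨z, hz, hzmax⟩ : ∃ z ∈ Ico a b, ∀ y ∈ Icc a b, W y ≤ W z := by
    obtain ⟨z, hz, hzmax⟩ := isCompact_Icc.exists_isMaxOn (nonempty_Icc.2 hab) hWc
    rcases hz.2.eq_or_lt with rfl | hzb
    · exact ⟨a, ⟨le_rfl, hab'⟩, fun y hy => hWab ▸ hzmax hy⟩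
    · exact ⟨z, ⟨hz.1, hzb⟩, fun y hy => hzmax hy⟩
  obtain ⟨δ, hδ, hδb, hr⟩ := h z hz
  have hsub : Icc z (z + δ) ⊆ Icc a b := Icc_subset_Icc hz.1 hδb
  have hd : HasDerivWithinAt (fun y => η * y) η (Icc z (z + δ)) z := by
    simpa using ((hasDerivAt_id z).const_mul η).hasDerivWithinAt
  have h1 := le_lowerLaplaceRight_of_eqOn (H := W) hδ zero_le_one (hU.mono hsub) hr
    (by fun_prop) hd fun y _ => rfl
  rw [coe_le_lowerLaplaceRight_iff] at h1
  obtain ⟨s, hs⟩ := (h1 (η / 2) (half_pos hη0)).exists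
  have h2 : laplaceQuotRight W z δ s ≤ 0 := by
    refine mul_nonpos_of_nonneg_of_nonpos (sq_nonneg s) ?_
    rw [← neg_nonneg, ← intervalIntegral.integral_neg]
    refine intervalIntegral.integral_nonneg hδ.le fun t ht => ?_
    have := hzmax (z + t) (hsub ⟨by linarith [ht.1], by linarith [ht.2]⟩)
    nlinarith [Real.exp_pos (-(s * t))]
  linarith

/-! ### Major and minor functions -/

theorem isLaplaceMinor_iff {f V : ℝ → ℝ} {a b : ℝ} :
    IsLaplaceMinor f a b V ↔ IsLaplaceMajor (fun x => -f x) a b (fun x => -V x) := by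
  constructor
  · intro h
    refine ⟨h.continuousOn.neg, by simp [h.left_eq_zero], fun x hx => ?_, fun x hx => ?_⟩
    · obtain ⟨δ, h1, h2, h3⟩ := h.right_le x hx
      exact ⟨δ, h1, h2, upperLaplaceRight_le_coe_iff.1 h3⟩
    · obtain ⟨δ, h1, h2, h3⟩ := h.left_le x hx
      exact ⟨δ, h1, h2, upperLaplaceLeft_le_coe_iff.1 h3⟩
  · intro h
    refine ⟨by simpa using h.continuousOn.fun_neg, by simpa using h.left_eq_zero,
      fun x hx => ?_, fun x hx => ?_⟩
    · obtain ⟨δ, h1, h2, h3⟩ := h.right_ge x hx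
      exact ⟨δ, h1, h2, upperLaplaceRight_le_coe_iff.2 h3⟩
    · obtain ⟨δ, h1, h2, h3⟩ := h.left_ge x hx
      exact ⟨δ, h1, h2, upperLaplaceLeft_le_coe_iff.2 h3⟩

theorem IsLaplaceMajor.isLaplaceMinor_neg {f U : ℝ → ℝ} {a b : ℝ} (h : IsLaplaceMajor f a b U) :
    IsLaplaceMinor (fun x => -f x) a b (fun x => -U x) :=
  isLaplaceMinor_iff.2 (by simpa using h)

/-- At each point `x`, `H` is a multiple of the major function `U` plus a function that is
differentiable at `x`, where the multiple and the remainder may depend on `x`. -/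
theorem IsLaplaceMajor.of_eqOn {f h U H : ℝ → ℝ} {a b : ℝ} (hU : IsLaplaceMajor f a b U)
    (hHc : ContinuousOn H (Icc a b)) (hHa : H a = 0)
    (hH : ∀ x ∈ Icc a b, ∃ (k m : ℝ) (R : ℝ → ℝ), 0 ≤ k ∧ ContinuousOn R (Icc a b) ∧
      HasDerivWithinAt R m (Icc a b) x ∧ EqOn H (fun y => k * U y + R y) (Icc a b) ∧
      h x = k * f x + m) :
    IsLaplaceMajor h a b H := by
  refine ⟨hHc, hHa, fun x hx => ?_, fun x hx => ?_⟩
  · obtain ⟨δ, h1, h2, h3⟩ := hU.right_ge x hx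
    obtain ⟨k, m, R, hk, hR, hd, he, hx'⟩ := hH x (Ico_subset_Icc_self hx)
    have hs : Icc x (x + δ) ⊆ Icc a b := Icc_subset_Icc hx.1 h2
    refine ⟨δ, h1, h2, ?_⟩
    rw [hx']
    exact le_lowerLaplaceRight_of_eqOn h1 hk (hU.continuousOn.mono hs) h3 (hR.mono hs)
      (hd.mono hs) (he.mono hs)
  · obtain ⟨δ, h1, h2, h3⟩ := hU.left_ge x hx
    obtain ⟨k, m, R, hk, hR, hd, he, hx'⟩ := hH x (Ioc_subset_Icc_self hx)
    have hs : Icc (x - δ) x ⊆ Icc a b := Icc_subset_Icc h2 hx.2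
    refine ⟨δ, h1, h2, ?_⟩
    rw [hx']
    exact le_lowerLaplaceLeft_of_eqOn h1 hk (hU.continuousOn.mono hs) h3 (hR.mono hs)
      (hd.mono hs) (he.mono hs)

theorem isLaplaceMajor_zero (a b : ℝ) : IsLaplaceMajor (fun _ => 0) a b (fun _ => 0) := by
  refine ⟨continuousOn_const, rfl, fun x hx => ⟨b - x, by linarith [hx.2], by linarith, ?_⟩,
    fun x hx => ⟨x - a, by linarith [hx.1], by linarith, ?_⟩⟩
  · simp [lowerLaplaceRight, laplaceQuotRight]
  · simp [lowerLaplaceLeft, laplaceQuotLeft]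

theorem IsLaplaceMajor.const_mul {f U : ℝ → ℝ} {a b k : ℝ} (hU : IsLaplaceMajor f a b U)
    (hk : 0 ≤ k) : IsLaplaceMajor (fun x => k * f x) a b (fun x => k * U x) :=
  hU.of_eqOn (continuousOn_const.mul hU.continuousOn) (by simp [hU.left_eq_zero]) fun x _ =>
    ⟨k, 0, fun _ => 0, hk, continuousOn_const, hasDerivWithinAt_const _ _ _,
      fun y _ => by simp, by simp⟩

theorem IsLaplaceMajor.add {f g U W : ℝ → ℝ} {a b : ℝ} (hU : IsLaplaceMajor f a b U)
    (hW : IsLaplaceMajor g a b W) :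
    IsLaplaceMajor (fun x => f x + g x) a b (fun x => U x + W x) := by
  refine ⟨hU.continuousOn.add hW.continuousOn, by simp [hU.left_eq_zero, hW.left_eq_zero],
    fun x hx => ?_, fun x hx => ?_⟩
  · obtain ⟨δ, h1, h2, h3⟩ := hU.right_ge x hx
    obtain ⟨δ', h1', h2', h3'⟩ := hW.right_ge x hx
    have hm : 0 < min δ δ' := lt_min h1 h1'
    have hs : x + min δ δ' ≤ b := by linarith [min_le_left δ δ']
    exact ⟨min δ δ', hm, hs, lowerLaplaceRight_add_le hm
      (hU.continuousOn.mono (Icc_subset_Icc hx.1 hs))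
      (le_lowerLaplaceRight_of_le hm (min_le_left _ _)
        (hU.continuousOn.mono (Icc_subset_Icc hx.1 h2)) h3)
      (hW.continuousOn.mono (Icc_subset_Icc hx.1 hs))
      (le_lowerLaplaceRight_of_le hm (min_le_right _ _)
        (hW.continuousOn.mono (Icc_subset_Icc hx.1 h2')) h3')⟩
  · obtain ⟨δ, h1, h2, h3⟩ := hU.left_ge x hx
    obtain ⟨δ', h1', h2', h3'⟩ := hW.left_ge x hx
    have hm : 0 < min δ δ' := lt_min h1 h1'
    have hs : a ≤ x - min δ δ' := by linarith [min_le_left δ δ']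
    exact ⟨min δ δ', hm, hs, lowerLaplaceLeft_add_le hm
      (hU.continuousOn.mono (Icc_subset_Icc hs hx.2))
      (le_lowerLaplaceLeft_of_le hm (min_le_left _ _)
        (hU.continuousOn.mono (Icc_subset_Icc h2 hx.2)) h3)
      (hW.continuousOn.mono (Icc_subset_Icc hs hx.2))
      (le_lowerLaplaceLeft_of_le hm (min_le_right _ _)
        (hW.continuousOn.mono (Icc_subset_Icc h2' hx.2)) h3')⟩

theorem IsLaplaceMajor.restrict {f U : ℝ → ℝ} {a b c d : ℝ} (hU : IsLaplaceMajor f a b U)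
    (hac : a ≤ c) (hdb : d ≤ b) : IsLaplaceMajor f c d (fun x => U x - U c) := by
  have hs : Icc c d ⊆ Icc a b := Icc_subset_Icc hac hdb
  refine ⟨(hU.continuousOn.mono hs).sub continuousOn_const, sub_self _,
    fun x hx => ?_, fun x hx => ?_⟩
  · have hx' : x ∈ Ico a b := ⟨hac.trans hx.1, hx.2.trans_le hdb⟩
    obtain ⟨δ, h1, h2, h3⟩ := hU.right_ge x hx'
    have hm : 0 < min δ (d - x) := lt_min h1 (by linarith [hx.2])
    have hle : x + min δ (d - x) ≤ d := by linarith [min_le_right δ (d - x)]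
    refine ⟨min δ (d - x), hm, hle, ?_⟩
    have := le_lowerLaplaceRight_of_eqOn (H := fun x => U x - U c) (R := fun _ => -U c) (m := 0)
      hm zero_le_one (hU.continuousOn.mono (Icc_subset_Icc hx'.1 (hle.trans hdb)))
      (le_lowerLaplaceRight_of_le hm (min_le_left _ _)
        (hU.continuousOn.mono (Icc_subset_Icc hx'.1 h2)) h3)
      continuousOn_const (hasDerivWithinAt_const _ _ _) fun y _ => by ring
    simpa using this
  · have hx' : x ∈ Ioc a b := ⟨hac.trans_lt hx.1, hx.2.trans hdb⟩
    obtain ⟨δ, h1, h2, h3⟩ := hU.left_ge x hx'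
    have hm : 0 < min δ (x - c) := lt_min h1 (by linarith [hx.1])
    have hle : c ≤ x - min δ (x - c) := by linarith [min_le_right δ (x - c)]
    refine ⟨min δ (x - c), hm, hle, ?_⟩
    have := le_lowerLaplaceLeft_of_eqOn (H := fun x => U x - U c) (R := fun _ => -U c) (m := 0)
      hm zero_le_one (hU.continuousOn.mono (Icc_subset_Icc (hac.trans hle) hx'.2))
      (le_lowerLaplaceLeft_of_le hm (min_le_left _ _)
        (hU.continuousOn.mono (Icc_subset_Icc h2 hx'.2)) h3)
      continuousOn_const (hasDerivWithinAt_const _ _ _) fun y _ => by ring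
    simpa using this

theorem IsLaplaceMajor.glue {f U W : ℝ → ℝ} {a b c : ℝ} (hU : IsLaplaceMajor f a c U)
    (hW : IsLaplaceMajor f c b W) (hac : a ≤ c) :
    IsLaplaceMajor f a b (fun x => if x ≤ c then U x else U c + W x) := by
  set H : ℝ → ℝ := fun x => if x ≤ c then U x else U c + W x with hH
  have h1 : EqOn H U (Iic c) := fun y hy => if_pos hy
  have h2 : EqOn H (fun y => U c + W y) (Ici c) := by
    intro y hy
    rcases (mem_Ici.1 hy).eq_or_lt with rfl | hlt
    · simp [hH, hW.left_eq_zero]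
    · exact if_neg (not_le.2 hlt)
  have hc1 : ContinuousOn H (Icc a c) := hU.continuousOn.congr (h1.mono Icc_subset_Iic_self)
  have hc2 : ContinuousOn H (Icc c b) :=
    (continuousOn_const.add hW.continuousOn).congr (h2.mono Icc_subset_Ici_self)
  refine ⟨?_, by rw [h1 hac, hU.left_eq_zero], fun x hx => ?_, fun x hx => ?_⟩
  · refine (hc1.union_of_isClosed hc2 isClosed_Icc isClosed_Icc).mono fun y hy => ?_
    rcases le_total y c with h | h
    exacts [Or.inl ⟨hy.1, h⟩, Or.inr ⟨h, hy.2⟩]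
  · rcases lt_or_ge x c with hxc | hxc
    · obtain ⟨δ, d1, d2, d3⟩ := hU.right_ge x ⟨hx.1, hxc⟩
      by_cases hcb : c ≤ b
      · refine ⟨δ, d1, d2.trans hcb, ?_⟩
        rwa [lowerLaplaceRight_congr d1 (h1.mono fun y hy => hy.2.trans d2)]
      · have hm : 0 < min δ (b - x) := lt_min d1 (by linarith [hx.2])
        refine ⟨min δ (b - x), hm, by linarith [min_le_right δ (b - x)], ?_⟩
        rw [lowerLaplaceRight_congr hm
          (h1.mono fun y hy => by have := hy.2; simp only [mem_Iic]; linarith [min_le_left δ (b - x)])]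
        exact le_lowerLaplaceRight_of_le hm (min_le_left _ _)
          (hU.continuousOn.mono (Icc_subset_Icc hx.1 d2)) d3
    · obtain ⟨δ, d1, d2, d3⟩ := hW.right_ge x ⟨hxc, hx.2⟩
      refine ⟨δ, d1, d2, ?_⟩
      have := le_lowerLaplaceRight_of_eqOn (H := H) (R := fun _ => U c) (m := 0)
        d1 zero_le_one (hW.continuousOn.mono (Icc_subset_Icc hxc d2)) d3
        continuousOn_const (hasDerivWithinAt_const _ _ _)
        fun y hy => by rw [h2 (hxc.trans hy.1)]; ring
      simpa using this
  · rcases le_or_gt x c with hxc | hxc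
    · obtain ⟨δ, d1, d2, d3⟩ := hU.left_ge x ⟨hx.1, hxc⟩
      refine ⟨δ, d1, d2, ?_⟩
      have := le_lowerLaplaceLeft_of_eqOn (H := H) (R := fun _ => 0) (m := 0)
        d1 zero_le_one (hU.continuousOn.mono (Icc_subset_Icc d2 hxc)) d3
        continuousOn_const (hasDerivWithinAt_const _ _ _)
        fun y hy => by rw [h1 (hy.2.trans hxc)]; ring
      simpa using this
    · obtain ⟨δ, d1, d2, d3⟩ := hW.left_ge x ⟨hxc, hx.2⟩
      refine ⟨δ, d1, hac.trans d2, ?_⟩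
      have := le_lowerLaplaceLeft_of_eqOn (H := H) (R := fun _ => U c) (m := 0)
        d1 zero_le_one (hW.continuousOn.mono (Icc_subset_Icc d2 hx.2)) d3
        continuousOn_const (hasDerivWithinAt_const _ _ _)
        fun y hy => by rw [h2 (d2.trans hy.1)]; ring
      simpa using this

theorem IsLaplaceMajor.reflect {f U : ℝ → ℝ} {a b : ℝ} (hU : IsLaplaceMajor f a b U) (k : ℝ) :
    IsLaplaceMajor (fun x => f (k - x)) (k - b) (k - a) (fun x => U b - U (k - x)) := by
  refine ⟨continuousOn_const.sub (hU.continuousOn.comp (by fun_prop) fun y hy =>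
    ⟨by linarith [hy.2], by linarith [hy.1]⟩), by simp, fun x hx => ?_, fun x hx => ?_⟩
  · obtain ⟨δ, h1, h2, h3⟩ := hU.left_ge (k - x) ⟨by linarith [hx.2], by linarith [hx.1]⟩
    exact ⟨δ, h1, by linarith, by rwa [lowerLaplaceRight_reflect]⟩
  · obtain ⟨δ, h1, h2, h3⟩ := hU.right_ge (k - x) ⟨by linarith [hx.2], by linarith [hx.1]⟩
    exact ⟨δ, h1, by linarith, by rwa [lowerLaplaceLeft_reflect]⟩

/-- The difference of a major and a minor function is nondecreasing. -/
theorem IsLaplaceMajor.sub_le_sub {f U V : ℝ → ℝ} {a b c d : ℝ} (hU : IsLaplaceMajor f a b U)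
    (hV : IsLaplaceMinor f a b V) (hac : a ≤ c) (hcd : c ≤ d) (hdb : d ≤ b) :
    U c - V c ≤ U d - V d := by
  have h := (hU.add (isLaplaceMinor_iff.1 hV)).restrict hac hdb
  have := le_of_zero_le_lowerLaplaceRight hcd h.continuousOn fun x hx => by
    obtain ⟨δ, h1, h2, h3⟩ := h.right_ge x hx
    exact ⟨δ, h1, h2, by simpa using h3⟩
  linarith

/-! ### The integral over a compact interval -/

/-- `f` is Laplace integrable on `[a, b]` with integral `I`. -/
def HasLaplaceIntegralIcc (f : ℝ → ℝ) (a b I : ℝ) : Prop :=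
  ∀ ε > 0, ∃ U V : ℝ → ℝ, IsLaplaceMajor f a b U ∧ IsLaplaceMinor f a b V ∧
    U b ≤ I + ε ∧ I - ε ≤ V b

theorem IsLaplaceMajor.minor_le {f U V : ℝ → ℝ} {a b : ℝ} (hU : IsLaplaceMajor f a b U)
    (hV : IsLaplaceMinor f a b V) (hab : a ≤ b) : V b ≤ U b := by
  have := hU.sub_le_sub hV le_rfl hab le_rfl
  rw [hU.left_eq_zero, hV.left_eq_zero] at this
  linarith

theorem HasLaplaceIntegralIcc.le_major {f U : ℝ → ℝ} {a b I : ℝ}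
    (h : HasLaplaceIntegralIcc f a b I) (hab : a ≤ b) (hU : IsLaplaceMajor f a b U) :
    I ≤ U b := by
  refine le_of_forall_pos_le_add fun ε hε => ?_
  obtain ⟨_, V, _, hV, _, h2⟩ := h ε hε
  linarith [hU.minor_le hV hab]

theorem HasLaplaceIntegralIcc.neg {f : ℝ → ℝ} {a b I : ℝ} (h : HasLaplaceIntegralIcc f a b I) :
    HasLaplaceIntegralIcc (fun x => -f x) a b (-I) := by
  intro ε hε
  obtain ⟨U, V, hU, hV, h1, h2⟩ := h ε hε
  exact ⟨_, _, isLaplaceMinor_iff.1 hV, hU.isLaplaceMinor_neg, by linarith, by linarith⟩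

theorem hasLaplaceIntegralIcc_of_major {f : ℝ → ℝ} {a b I : ℝ}
    (h1 : ∀ ε > 0, ∃ U, IsLaplaceMajor f a b U ∧ U b ≤ I + ε)
    (h2 : ∀ ε > 0, ∃ U, IsLaplaceMajor (fun x => -f x) a b U ∧ U b ≤ -I + ε) :
    HasLaplaceIntegralIcc f a b I := by
  intro ε hε
  obtain ⟨U, hU, hUb⟩ := h1 ε hε
  obtain ⟨W, hW, hWb⟩ := h2 ε hε
  exact ⟨U, fun x => -W x, hU, by simpa using hW.isLaplaceMinor_neg, hUb, by linarith⟩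

theorem HasLaplaceIntegralIcc.exists_major {f : ℝ → ℝ} {a b I : ℝ}
    (h : HasLaplaceIntegralIcc f a b I) : ∀ ε > 0, ∃ U, IsLaplaceMajor f a b U ∧ U b ≤ I + ε := by
  intro ε hε
  obtain ⟨U, _, hU, _, h1, _⟩ := h ε hε
  exact ⟨U, hU, h1⟩

theorem HasLaplaceIntegralIcc.add {f g : ℝ → ℝ} {a b I J : ℝ}
    (hf : HasLaplaceIntegralIcc f a b I) (hg : HasLaplaceIntegralIcc g a b J) :
    HasLaplaceIntegralIcc (fun x => f x + g x) a b (I + J) := by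
  have key : ∀ {f g : ℝ → ℝ} {I J : ℝ}, HasLaplaceIntegralIcc f a b I →
      HasLaplaceIntegralIcc g a b J → ∀ ε > 0, ∃ U, IsLaplaceMajor (fun x => f x + g x) a b U ∧
      U b ≤ I + J + ε := by
    intro f g I J hf hg ε hε
    obtain ⟨U, hU, h1⟩ := hf.exists_major _ (half_pos hε)
    obtain ⟨W, hW, h2⟩ := hg.exists_major _ (half_pos hε)
    exact ⟨_, hU.add hW, by linarith⟩
  refine hasLaplaceIntegralIcc_of_major (key hf hg) fun ε hε => ?_
  obtain ⟨U, hU, h1⟩ := key hf.neg hg.neg ε hε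
  refine ⟨U, ?_, by linarith⟩
  simpa only [neg_add] using hU

theorem HasLaplaceIntegralIcc.const_mul {f : ℝ → ℝ} {a b I : ℝ}
    (h : HasLaplaceIntegralIcc f a b I) (k : ℝ) :
    HasLaplaceIntegralIcc (fun x => k * f x) a b (k * I) := by
  have key : ∀ {f : ℝ → ℝ} {I k : ℝ}, 0 ≤ k → HasLaplaceIntegralIcc f a b I →
      ∀ ε > 0, ∃ U, IsLaplaceMajor (fun x => k * f x) a b U ∧ U b ≤ k * I + ε := by
    intro f I k hk hf ε hε
    have hk1 : 0 < k + 1 := by linarith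
    obtain ⟨U, hU, h1⟩ := hf.exists_major (ε / (k + 1)) (by positivity)
    refine ⟨_, hU.const_mul hk, (mul_le_mul_of_nonneg_left h1 hk).trans ?_⟩
    have : k * (ε / (k + 1)) ≤ ε := by
      rw [mul_div_assoc', div_le_iff₀ hk1]
      nlinarith
    linarith
  have key' : ∀ {f : ℝ → ℝ} {I k : ℝ}, 0 ≤ k → HasLaplaceIntegralIcc f a b I →
      HasLaplaceIntegralIcc (fun x => k * f x) a b (k * I) := by
    intro f I k hk hf
    refine hasLaplaceIntegralIcc_of_major (key hk hf) fun ε hε => ?_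
    obtain ⟨U, hU, h1⟩ := key hk hf.neg ε hε
    refine ⟨U, ?_, by linarith⟩
    simpa only [mul_neg] using hU
  rcases le_total 0 k with hk | hk
  · exact key' hk h
  · simpa using key' (neg_nonneg.2 hk) h.neg

theorem HasLaplaceIntegralIcc.glue {f : ℝ → ℝ} {a b c I J : ℝ}
    (hI : HasLaplaceIntegralIcc f a c I) (hJ : HasLaplaceIntegralIcc f c b J) (hac : a ≤ c)
    (hcb : c ≤ b) : HasLaplaceIntegralIcc f a b (I + J) := by
  have key : ∀ {f : ℝ → ℝ} {I J : ℝ}, HasLaplaceIntegralIcc f a c I →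
      HasLaplaceIntegralIcc f c b J → ∀ ε > 0, ∃ U, IsLaplaceMajor f a b U ∧
      U b ≤ I + J + ε := by
    intro f I J hf hg ε hε
    obtain ⟨U, hU, h1⟩ := hf.exists_major _ (half_pos hε)
    obtain ⟨W, hW, h2⟩ := hg.exists_major _ (half_pos hε)
    refine ⟨_, hU.glue hW hac, ?_⟩
    rcases hcb.eq_or_lt with rfl | hlt
    · have := hW.left_eq_zero
      simp only [le_refl, if_true]
      linarith
    · simp only [not_le.2 hlt, if_false]
      linarith
  refine hasLaplaceIntegralIcc_of_major (key hI hJ) fun ε hε => ?_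
  obtain ⟨U, hU, h1⟩ := key hI.neg hJ.neg ε hε
  exact ⟨U, hU, by linarith⟩

theorem HasLaplaceIntegralIcc.reflect {f : ℝ → ℝ} {a b I : ℝ}
    (h : HasLaplaceIntegralIcc f a b I) (k : ℝ) :
    HasLaplaceIntegralIcc (fun x => f (k - x)) (k - b) (k - a) I := by
  have key : ∀ {f : ℝ → ℝ} {I : ℝ}, HasLaplaceIntegralIcc f a b I →
      ∀ ε > 0, ∃ U, IsLaplaceMajor (fun x => f (k - x)) (k - b) (k - a) U ∧
      U (k - a) ≤ I + ε := by
    intro f I hf ε hε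
    obtain ⟨U, hU, h1⟩ := hf.exists_major ε hε
    exact ⟨_, hU.reflect k, by simpa [hU.left_eq_zero] using h1⟩
  exact hasLaplaceIntegralIcc_of_major (key h) (key h.neg)

theorem HasLaplaceIntegralIcc.laplaceIntegrableIcc {f : ℝ → ℝ} {a b I : ℝ}
    (h : HasLaplaceIntegralIcc f a b I) : LaplaceIntegrableIcc f a b := by
  intro ε hε
  obtain ⟨U, V, hU, hV, h1, h2⟩ := h (ε / 2) (half_pos hε)
  exact ⟨U, V, hU, hV, by linarith⟩

theorem HasLaplaceIntegralIcc.laplaceIntegralIcc_eq {f : ℝ → ℝ} {a b I : ℝ}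
    (h : HasLaplaceIntegralIcc f a b I) (hab : a ≤ b) : laplaceIntegralIcc f a b = I := by
  refine IsGLB.csInf_eq ⟨?_, fun r hr => le_of_forall_pos_le_add fun ε hε => ?_⟩ ?_
  · rintro _ ⟨U, hU, rfl⟩
    exact h.le_major hab hU
  · obtain ⟨U, hU, h1⟩ := h.exists_major ε hε
    exact (hr ⟨U, hU, rfl⟩).trans h1
  · obtain ⟨U, hU, _⟩ := h.exists_major 1 one_pos
    exact ⟨_, U, hU, rfl⟩

theorem LaplaceIntegrableIcc.hasLaplaceIntegralIcc {f : ℝ → ℝ} {a b : ℝ}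
    (h : LaplaceIntegrableIcc f a b) (hab : a ≤ b) :
    HasLaplaceIntegralIcc f a b (laplaceIntegralIcc f a b) := by
  intro ε hε
  obtain ⟨U, V, hU, hV, h1⟩ := h ε hε
  have h2 : laplaceIntegralIcc f a b ≤ U b := by
    refine csInf_le ⟨V b, ?_⟩ ⟨U, hU, rfl⟩
    rintro _ ⟨W, hW, rfl⟩
    exact hW.minor_le hV hab
  have h3 : V b ≤ laplaceIntegralIcc f a b := by
    refine le_csInf ⟨_, U, hU, rfl⟩ ?_
    rintro _ ⟨W, hW, rfl⟩
    exact hW.minor_le hV hab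
  exact ⟨U, V, hU, hV, by linarith, by linarith⟩

theorem HasLaplaceIntegralIcc.unique {f : ℝ → ℝ} {a b I J : ℝ} (hab : a ≤ b)
    (h : HasLaplaceIntegralIcc f a b I) (h' : HasLaplaceIntegralIcc f a b J) : I = J := by
  rw [← h.laplaceIntegralIcc_eq hab, h'.laplaceIntegralIcc_eq hab]

theorem LaplaceIntegrableIcc.restrict {f : ℝ → ℝ} {a b c d : ℝ} (h : LaplaceIntegrableIcc f a b)
    (hac : a ≤ c) (hcd : c ≤ d) (hdb : d ≤ b) : LaplaceIntegrableIcc f c d := by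
  intro ε hε
  obtain ⟨U, V, hU, hV, h1⟩ := h ε hε
  refine ⟨fun x => U x - U c, fun x => V x - V c, hU.restrict hac hdb, ?_, ?_⟩
  · have := (isLaplaceMinor_iff.1 hV).restrict hac hdb
    rw [isLaplaceMinor_iff]
    convert this using 2
    ring
  · have h2 := hU.sub_le_sub hV le_rfl hac (hcd.trans hdb)
    have h3 := hU.sub_le_sub hV (hac.trans hcd) hdb le_rfl
    rw [hU.left_eq_zero, hV.left_eq_zero] at h2
    linarith

/-! ### Primitives on the real line -/

/-- `P` is a primitive of `f`: `∫_c^d f = P d - P c` for all `c ≤ d`. -/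
def IsLaplacePrimitive (f P : ℝ → ℝ) : Prop :=
  ∀ c d, c ≤ d → HasLaplaceIntegralIcc f c d (P d - P c)

namespace IsLaplacePrimitive

variable {f P : ℝ → ℝ}

theorem sub_const (h : IsLaplacePrimitive f P) (k : ℝ) :
    IsLaplacePrimitive f (fun x => P x - k) := fun c d hcd => by
  simpa using h c d hcd

theorem tendsto_integral_atBot (h : IsLaplacePrimitive f P) {l : ℝ}
    (hl : Tendsto P atBot (𝓝 l)) (t : ℝ) :
    Tendsto (fun c => laplaceIntegralIcc f c t) atBot (𝓝 (P t - l)) := by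
  refine (tendsto_const_nhds.sub hl).congr' ?_
  filter_upwards [eventually_le_atBot t] with c hc
  exact ((h c t hc).laplaceIntegralIcc_eq hc).symm

theorem tendsto_integral_atTop (h : IsLaplacePrimitive f P) {l : ℝ}
    (hl : Tendsto P atTop (𝓝 l)) (t : ℝ) :
    Tendsto (fun c => laplaceIntegralIcc f t c) atTop (𝓝 (l - P t)) := by
  refine (hl.sub tendsto_const_nhds).congr' ?_
  filter_upwards [eventually_ge_atTop t] with c hc
  exact ((h t c hc).laplaceIntegralIcc_eq hc).symm

theorem laplaceIntegrableIic (h : IsLaplacePrimitive f P) {l : ℝ}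
    (hl : Tendsto P atBot (𝓝 l)) (t : ℝ) : LaplaceIntegrableIic f t :=
  ⟨fun c hc => (h c t hc).laplaceIntegrableIcc, _, h.tendsto_integral_atBot hl t⟩

theorem laplaceIntegrableIci (h : IsLaplacePrimitive f P) {l : ℝ}
    (hl : Tendsto P atTop (𝓝 l)) (t : ℝ) : LaplaceIntegrableIci f t :=
  ⟨fun c hc => (h t c hc).laplaceIntegrableIcc, _, h.tendsto_integral_atTop hl t⟩

theorem laplaceIntegralIic_eq (h : IsLaplacePrimitive f P) {l : ℝ}
    (hl : Tendsto P atBot (𝓝 l)) (t : ℝ) : laplaceIntegralIic f t = P t - l :=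
  (h.tendsto_integral_atBot hl t).limUnder_eq

theorem laplaceIntegralIci_eq (h : IsLaplacePrimitive f P) {l : ℝ}
    (hl : Tendsto P atTop (𝓝 l)) (t : ℝ) : laplaceIntegralIci f t = l - P t :=
  (h.tendsto_integral_atTop hl t).limUnder_eq

theorem laplaceIntegrable (h : IsLaplacePrimitive f P) {l l' : ℝ}
    (hl : Tendsto P atBot (𝓝 l)) (hl' : Tendsto P atTop (𝓝 l')) : LaplaceIntegrable f :=
  ⟨0, h.laplaceIntegrableIic hl 0, h.laplaceIntegrableIci hl' 0⟩

theorem laplaceIntegral_eq (h : IsLaplacePrimitive f P) {l l' : ℝ}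
    (hl : Tendsto P atBot (𝓝 l)) (hl' : Tendsto P atTop (𝓝 l')) :
    laplaceIntegral f = l' - l := by
  rw [laplaceIntegral, dif_pos (h.laplaceIntegrable hl hl'), h.laplaceIntegralIic_eq hl,
    h.laplaceIntegralIci_eq hl']
  ring

theorem const_mul (h : IsLaplacePrimitive f P) (k : ℝ) :
    IsLaplacePrimitive (fun x => k * f x) (fun x => k * P x) := fun c d hcd => by
  simpa [mul_sub] using (h c d hcd).const_mul k

theorem comp_sub_left (h : IsLaplacePrimitive f P) (k : ℝ) :
    IsLaplacePrimitive (fun x => f (k - x)) (fun x => -P (k - x)) := fun c d hcd => by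
  have := (h (k - d) (k - c) (by linarith)).reflect k
  rw [sub_sub_cancel, sub_sub_cancel] at this
  convert this using 1
  ring

theorem comp_sub_right (h : IsLaplacePrimitive f P) (k : ℝ) :
    IsLaplacePrimitive (fun x => f (x - k)) (fun x => P (x - k)) := by
  have h2 := (h.comp_sub_left (-k)).comp_sub_left 0
  have e : ∀ x : ℝ, -k - (0 - x) = x - k := fun x => by ring
  simpa only [e, neg_neg] using h2

/-- Every primitive is continuous, as a uniform limit of major functions. -/
protected theorem continuous (h : IsLaplacePrimitive f P) : Continuous P := by
  rw [continuous_iff_continuousAt]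
  intro x
  have hx : Icc (x - 1) (x + 1) ∈ 𝓝 x := Icc_mem_nhds (by linarith) (by linarith)
  refine ContinuousOn.continuousAt ?_ hx
  refine continuousOn_of_uniform_approx_of_continuousOn fun u hu => ?_
  obtain ⟨ε, hε, hεu⟩ := Metric.mem_uniformity_dist.1 hu
  obtain ⟨U, hU, hUb⟩ := (h (x - 1) (x + 1) (by linarith)).exists_major (ε / 2) (half_pos hε)
  refine ⟨fun y => U y + P (x - 1), hU.continuousOn.add continuousOn_const, fun y hy => hεu ?_⟩
  have h1 := (h (x - 1) y hy.1).le_major hy.1 (hU.restrict le_rfl hy.2)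
  have h2 := (h y (x + 1) hy.2).le_major hy.2 (hU.restrict hy.1 le_rfl)
  rw [hU.left_eq_zero] at h1
  rw [Real.dist_eq, abs_lt]
  constructor <;> linarith

end IsLaplacePrimitive

theorem LaplaceIntegrable.exists_primitive {f : ℝ → ℝ} (hf : LaplaceIntegrable f) :
    ∃ (P : ℝ → ℝ) (l l' : ℝ), IsLaplacePrimitive f P ∧ Tendsto P atBot (𝓝 l) ∧
      Tendsto P atTop (𝓝 l') := by
  obtain ⟨a, ⟨hb, l, hl⟩, ht, l', hl'⟩ := hf
  refine ⟨fun x => if x ≤ a then -laplaceIntegralIcc f x a else laplaceIntegralIcc f a x,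
    -l, l', fun c d hcd => ?_, ?_, ?_⟩
  · rcases le_or_gt d a with hda | hda
    · have hc := (hb c (hcd.trans hda)).hasLaplaceIntegralIcc (hcd.trans hda)
      have hd := (hb d hda).hasLaplaceIntegralIcc hda
      have hcd' := ((hb c (hcd.trans hda)).restrict le_rfl hcd hda).hasLaplaceIntegralIcc hcd
      have := (hcd'.glue hd hcd hda).unique (hcd.trans hda) hc
      simp only [if_pos hda, if_pos (hcd.trans hda)]
      convert hcd' using 1
      linarith
    · have hd := (ht d hda.le).hasLaplaceIntegralIcc hda.le
      rcases le_or_gt c a with hca | hca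
      · have hc := (hb c hca).hasLaplaceIntegralIcc hca
        simp only [if_neg (not_le.2 hda), if_pos hca]
        convert hc.glue hd hca hda.le using 1
        ring
      · have hc := (ht c hca.le).hasLaplaceIntegralIcc hca.le
        have hcd' := ((ht d hda.le).restrict hca.le hcd le_rfl).hasLaplaceIntegralIcc hcd
        have := (hc.glue hcd' hca.le hcd).unique hda.le hd
        simp only [if_neg (not_le.2 hda), if_neg (not_le.2 hca)]
        convert hcd' using 1
        linarith
  · refine hl.neg.congr' ?_
    filter_upwards [eventually_le_atBot a] with x hx
    rw [if_pos hx]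
  · refine hl'.congr' ?_
    filter_upwards [eventually_gt_atTop a] with x hx
    rw [if_neg (not_le.2 hx)]

/-- The primitive of a Laplace integrable function that vanishes at `-∞`. -/
theorem LaplaceIntegrable.isLaplacePrimitive_integralIic {f : ℝ → ℝ} (hf : LaplaceIntegrable f) :
    IsLaplacePrimitive f (laplaceIntegralIic f) ∧
      Tendsto (laplaceIntegralIic f) atBot (𝓝 0) ∧
      ∃ l, Tendsto (laplaceIntegralIic f) atTop (𝓝 l) := by
  obtain ⟨P, l, l', hP, hl, hl'⟩ := hf.exists_primitive
  have e : laplaceIntegralIic f = fun x => P x - l := funext (hP.laplaceIntegralIic_eq hl)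
  rw [e]
  exact ⟨hP.sub_const l, by simpa using hl.sub_const l, l' - l, hl'.sub_const l⟩

theorem isLaplaceMajor_integral {h : ℝ → ℝ} (hh : Continuous h) (a b : ℝ) :
    IsLaplaceMajor h a b (fun x => ∫ u in a..x, h u) := by
  have hd : ∀ x, HasDerivAt (fun x => ∫ u in a..x, h u) (h x) x := fun x =>
    intervalIntegral.integral_hasDerivAt_right (hh.intervalIntegrable _ _)
      (hh.stronglyMeasurableAtFilter _ _) hh.continuousAt
  have hc : Continuous (fun x => ∫ u in a..x, h u) :=
    continuous_iff_continuousAt.2 fun x => (hd x).continuousAt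
  exact (isLaplaceMajor_zero a b).of_eqOn hc.continuousOn (by simp) fun x _ =>
    ⟨0, h x, _, le_rfl, hc.continuousOn, (hd x).hasDerivWithinAt, fun y _ => by simp, by simp⟩

theorem Continuous.hasLaplaceIntegralIcc {h : ℝ → ℝ} (hh : Continuous h) (a b : ℝ) :
    HasLaplaceIntegralIcc h a b (∫ u in a..b, h u) := by
  refine hasLaplaceIntegralIcc_of_major (fun ε hε =>
    ⟨_, isLaplaceMajor_integral hh a b, by linarith⟩) fun ε hε =>
    ⟨_, isLaplaceMajor_integral hh.fun_neg a b, ?_⟩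
  simp only [intervalIntegral.integral_neg]
  linarith

theorem tendsto_integral_Iic_atBot {h : ℝ → ℝ} (hi : Integrable h) :
    Tendsto (fun t => ∫ u in Iic t, h u) atBot (𝓝 0) := by
  have h1 := intervalIntegral_tendsto_integral_Iic 0 hi.integrableOn tendsto_id
  have h2 := (tendsto_const_nhds (x := ∫ u in Iic 0, h u)).sub h1
  rw [sub_self] at h2
  refine h2.congr fun t => ?_
  rw [id, ← intervalIntegral.integral_Iic_sub_Iic hi.integrableOn hi.integrableOn]
  ring

theorem tendsto_integral_Iic_atTop {h : ℝ → ℝ} (hi : Integrable h) :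
    Tendsto (fun t => ∫ u in Iic t, h u) atTop (𝓝 (∫ u, h u)) := by
  have h1 := intervalIntegral_tendsto_integral_Ioi 0 hi.integrableOn tendsto_id
  have h2 := (tendsto_const_nhds (x := ∫ u in Iic 0, h u)).add h1
  rw [intervalIntegral.integral_Iic_add_Ioi hi.integrableOn hi.integrableOn] at h2
  refine h2.congr fun t => ?_
  rw [id, ← intervalIntegral.integral_Iic_sub_Iic hi.integrableOn hi.integrableOn]
  ring

theorem continuous_integral_Iic {g : ℝ → ℝ} (hg : Integrable g) :
    Continuous fun x => ∫ u in Iic x, g u := by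
  have : (fun x => ∫ u in Iic x, g u) =
      fun x => (∫ u in (0 : ℝ)..x, g u) + ∫ u in Iic 0, g u := by
    ext x
    rw [← intervalIntegral.integral_Iic_sub_Iic hg.integrableOn hg.integrableOn]
    ring
  rw [this]
  exact (intervalIntegral.continuous_primitive (fun _ _ => hg.intervalIntegrable) 0).add
    continuous_const

theorem Continuous.isLaplacePrimitive {h : ℝ → ℝ} (hh : Continuous h) (hi : Integrable h) :
    IsLaplacePrimitive h (fun t => ∫ u in Iic t, h u) := fun c d _ => by
  rw [intervalIntegral.integral_Iic_sub_Iic hi.integrableOn hi.integrableOn]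
  exact hh.hasLaplaceIntegralIcc c d

/-! ### Products -/

/-- Integration by parts for major functions: the formal derivative of `U K - ∫ U g` is `U' K`
if `K' = g`. -/
theorem IsLaplaceMajor.mul {f U K g : ℝ → ℝ} {a b M : ℝ} (hab : a ≤ b)
    (hU : IsLaplaceMajor f a b U)
    (hg : Integrable g) (hM : ∀ x, |g x| ≤ M) (hK : ∀ x y, K y - K x = ∫ u in x..y, g u)
    (hKc : Continuous K) (hK0 : ∀ x, 0 ≤ K x) :
    IsLaplaceMajor (fun x => f x * K x) a b (fun x => U x * K x - ∫ u in a..x, U u * g u) := by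
  have hM0 : 0 ≤ M := (abs_nonneg _).trans (hM 0)
  have hUg : IntervalIntegrable (fun u => U u * g u) volume a b :=
    hg.intervalIntegrable.continuousOn_mul (by rw [uIcc_of_le hab]; exact hU.continuousOn)
  have hsub : ∀ {x y}, x ∈ Icc a b → y ∈ Icc a b →
      IntervalIntegrable (fun u => U u * g u) volume x y := fun {x y} hx hy =>
    hUg.mono_set (by rw [uIcc_of_le hab]; exact uIcc_subset_Icc hx hy)
  have ha : a ∈ Icc a b := ⟨le_rfl, hab⟩
  have hcont : ContinuousOn (fun x => U x * K x - ∫ u in a..x, U u * g u) (Icc a b) := by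
    refine (hU.continuousOn.mul hKc.continuousOn).sub ?_
    have := intervalIntegral.continuousOn_primitive_interval (μ := volume)
      (f := fun u => U u * g u) (a := a) (b := b) (by
        rw [uIcc_of_le hab]
        exact (intervalIntegrable_iff_integrableOn_Icc_of_le hab).1 hUg)
    rwa [uIcc_of_le hab] at this
  refine hU.of_eqOn hcont (by simp [hU.left_eq_zero]) fun x hx =>
    ⟨K x, 0, fun y => (U y * K y - ∫ u in a..y, U u * g u) - K x * U y, hK0 x,
      hcont.sub (continuousOn_const.mul hU.continuousOn), ?_, fun y _ => by ring, by ring⟩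
  rw [hasDerivWithinAt_iff_isLittleO, Asymptotics.isLittleO_iff]
  intro c hc
  have hη : 0 < c / (2 * (M + 1)) := by positivity
  obtain ⟨η, hη0, hηU⟩ := Metric.continuousWithinAt_iff.1 (hU.continuousOn x hx) _ hη
  rw [eventually_nhdsWithin_iff, Metric.eventually_nhds_iff]
  refine ⟨η, hη0, fun y hy hyI => ?_⟩
  have hrepr : (U y * K y - ∫ u in a..y, U u * g u) - K x * U y -
      ((U x * K x - ∫ u in a..x, U u * g u) - K x * U x) - (y - x) • (0 : ℝ) =
      ∫ u in x..y, (U y - U u) * g u := by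
    have e1 := intervalIntegral.integral_add_adjacent_intervals (hsub ha hx) (hsub hx hyI)
    have e2 : ∫ u in x..y, (U y - U u) * g u = U y * (K y - K x) - ∫ u in x..y, U u * g u := by
      rw [hK, ← intervalIntegral.integral_const_mul, ← intervalIntegral.integral_sub
        (hg.intervalIntegrable.const_mul _) (hsub hx hyI)]
      congr 1
      ext u
      ring
    rw [e2, ← e1, smul_zero]
    ring
  rw [hrepr, Real.norm_eq_abs (y - x)]
  refine intervalIntegral.norm_integral_le_of_norm_le_const fun u hu => ?_
  have huI : u ∈ uIcc x y := uIoc_subset_uIcc hu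
  have hux : dist u x ≤ dist y x := by
    rw [Real.dist_eq, Real.dist_eq]
    exact abs_sub_left_of_mem_uIcc huI
  have h1 := hηU hyI hy
  have h2 := hηU (uIcc_subset_Icc hx hyI huI) (hux.trans_lt hy)
  rw [Real.dist_eq, abs_lt] at h1 h2
  have h3 : |U y - U u| ≤ c / (M + 1) := by
    have : c / (M + 1) = c / (2 * (M + 1)) + c / (2 * (M + 1)) := by field_simp; ring
    rw [this, abs_le]
    constructor <;> linarith [h1.1, h1.2, h2.1, h2.2]
  rw [norm_mul, Real.norm_eq_abs, Real.norm_eq_abs]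
  calc |U y - U u| * |g u| ≤ c / (M + 1) * M := by gcongr; exact hM u
    _ ≤ c := by
      rw [div_mul_eq_mul_div, div_le_iff₀ (by linarith)]
      nlinarith

namespace IsLaplacePrimitive

variable {f P : ℝ → ℝ}

theorem hasLaplaceIntegralIcc_mul_of_nonneg {K g : ℝ → ℝ} {M : ℝ} (h : IsLaplacePrimitive f P)
    (hg : Integrable g) (hM : ∀ x, |g x| ≤ M) (hK : ∀ x y, K y - K x = ∫ u in x..y, g u)
    (hKc : Continuous K) (hK0 : ∀ x, 0 ≤ K x) {a b : ℝ} (hab : a ≤ b) :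
    HasLaplaceIntegralIcc (fun x => f x * K x) a b
      (P b * K b - P a * K a - ∫ u in a..b, P u * g u) := by
  have key : ∀ {f P : ℝ → ℝ}, IsLaplacePrimitive f P → ∀ ε > 0, ∃ W,
      IsLaplaceMajor (fun x => f x * K x) a b W ∧
      W b ≤ P b * K b - P a * K a - (∫ u in a..b, P u * g u) + ε := by
    intro f P h ε hε
    set N : ℝ := K b + ∫ u in a..b, |g u| with hN
    have hN0 : 0 ≤ N :=
      add_nonneg (hK0 b) (intervalIntegral.integral_nonneg hab fun _ _ => abs_nonneg _)
    have hε' : 0 < ε / (N + 1) := by positivity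
    obtain ⟨U, hU, hUb⟩ := (h a b hab).exists_major (ε / (N + 1)) hε'
    refine ⟨_, hU.mul hab hg hM hK hKc hK0, ?_⟩
    have hUg : IntervalIntegrable (fun u => U u * g u) volume a b :=
      hg.intervalIntegrable.continuousOn_mul (by rw [uIcc_of_le hab]; exact hU.continuousOn)
    have hPg : IntervalIntegrable (fun u => P u * g u) volume a b :=
      hg.intervalIntegrable.continuousOn_mul h.continuous.continuousOn
    have e1 : ∫ u in a..b, (P u - P a - U u) * g u =
        (∫ u in a..b, P u * g u) - P a * (K b - K a) - ∫ u in a..b, U u * g u := by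
      rw [hK, ← intervalIntegral.integral_const_mul, ← intervalIntegral.integral_sub hPg
        (hg.intervalIntegrable.const_mul _), ← intervalIntegral.integral_sub
        (hPg.sub (hg.intervalIntegrable.const_mul _)) hUg]
      congr 1
      ext u
      ring
    have e2 : |∫ u in a..b, (P u - P a - U u) * g u| ≤
        ∫ u in a..b, ε / (N + 1) * |g u| := by
      refine intervalIntegral.norm_integral_le_of_norm_le (E := ℝ) (μ := volume) hab
        (Eventually.of_forall fun u hu => ?_) (hg.abs.intervalIntegrable.const_mul _)
      have h1 := (h a u hu.1.le).le_major hu.1.le (hU.restrict le_rfl hu.2)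
      have h2 := (h u b hu.2).le_major hu.2 (hU.restrict hu.1.le le_rfl)
      rw [hU.left_eq_zero] at h1
      rw [norm_mul, Real.norm_eq_abs, Real.norm_eq_abs]
      gcongr
      rw [abs_le]
      constructor <;> linarith
    rw [intervalIntegral.integral_const_mul] at e2
    have e3 := (le_abs_self _).trans e2
    have e4 := mul_le_mul_of_nonneg_right hUb (hK0 b)
    have e5 : ε / (N + 1) * N ≤ ε := by
      rw [div_mul_eq_mul_div, div_le_iff₀ (by linarith)]
      nlinarith
    rw [hN, mul_add] at e5
    linarith
  refine hasLaplaceIntegralIcc_of_major (key h) fun ε hε => ?_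
  have hneg : IsLaplacePrimitive (fun x => -f x) (fun x => -P x) := by
    simpa using h.const_mul (-1)
  obtain ⟨W, hW, hWb⟩ := key hneg ε hε
  refine ⟨W, by simpa only [neg_mul] using hW, ?_⟩
  simp only [neg_mul, intervalIntegral.integral_neg] at hWb
  linarith

/-- Integration by parts. -/
theorem mul_integral {g : ℝ → ℝ} {M B : ℝ} (h : IsLaplacePrimitive f P)
    (hB : ∀ x, |P x| ≤ B) (hg : Integrable g) (hM : ∀ x, |g x| ≤ M) :
    IsLaplacePrimitive (fun x => f x * ∫ u in Iic x, g u)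
      (fun x => P x * (∫ u in Iic x, g u) - ∫ u in Iic x, P u * g u) := by
  intro a b hab
  set C : ℝ := ∫ u, |g u| with hC
  have hPg : Integrable (fun u => P u * g u) :=
    hg.bdd_mul h.continuous.aestronglyMeasurable (Eventually.of_forall hB)
  have hG0 : ∀ x, 0 ≤ (∫ u in Iic x, g u) + C := by
    intro x
    have h1 : |∫ u in Iic x, g u| ≤ ∫ u in Iic x, |g u| := abs_integral_le_integral_abs
    have h2 : ∫ u in Iic x, |g u| ≤ C :=
      setIntegral_le_integral hg.abs (Eventually.of_forall fun _ => abs_nonneg _)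
    linarith [neg_abs_le (∫ u in Iic x, g u)]
  have hG : ∀ x y, (∫ u in Iic y, g u) + C - ((∫ u in Iic x, g u) + C) = ∫ u in x..y, g u := by
    intro x y
    rw [← intervalIntegral.integral_Iic_sub_Iic hg.integrableOn hg.integrableOn]
    ring
  have hGc : Continuous fun x => (∫ u in Iic x, g u) + C :=
    (continuous_integral_Iic hg).add continuous_const
  have h1 := h.hasLaplaceIntegralIcc_mul_of_nonneg hg hM hG hGc hG0 hab
  have h2 := h1.add ((h a b hab).const_mul (-C))
  rw [← intervalIntegral.integral_Iic_sub_Iic hPg.integrableOn hPg.integrableOn] at h2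
  convert h2 using 1
  · ext x
    ring
  · ring

end IsLaplacePrimitive

/-! ### Convolutions -/

theorem MeasureTheory.Integrable.eq_zero_of_tendsto_atTop {F : ℝ → ℝ} {l : ℝ} (hF : Integrable F)
    (h : Tendsto F atTop (𝓝 l)) : l = 0 := by
  refine IntegrableAtFilter.eq_zero_of_tendsto (μ := volume) (hF.integrableAtFilter atTop) ?_ h
  intro s hs
  obtain ⟨b, hb⟩ := mem_atTop_sets.1 hs
  rw [← top_le_iff, ← Real.volume_Ici (a := b)]
  exact measure_mono hb

theorem exists_abs_le_of_tendsto_zero {F : ℝ → ℝ} (hF : Continuous F)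
    (hb : Tendsto F atBot (𝓝 0)) (ht : Tendsto F atTop (𝓝 0)) : ∃ B, ∀ x, |F x| ≤ B := by
  have h0 : Tendsto F (cocompact ℝ) (𝓝 0) := by
    rw [cocompact_eq_atBot_atTop]
    exact hb.sup ht
  obtain ⟨B, hB⟩ := ZeroAtInftyContinuousMap.bounded (⟨⟨F, hF⟩, h0⟩ : ZeroAtInftyContinuousMap ℝ ℝ)
  refine ⟨B + |F 0|, fun x => ?_⟩
  have := hB x 0
  simp only [ZeroAtInftyContinuousMap.coe_mk, Real.dist_eq] at this
  have h2 := abs_add_le (F x - F 0) (F 0)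
  rw [sub_add_cancel] at h2
  exact h2.trans (by gcongr)

theorem BoundedVariationOn.exists_abs_le {g : ℝ → ℝ} (hg : BoundedVariationOn g univ) :
    ∃ M, ∀ x, |g x| ≤ M := by
  refine ⟨(eVariationOn g univ).toReal + |g 0|, fun x => ?_⟩
  have := hg.dist_le (mem_univ x) (mem_univ 0)
  rw [Real.dist_eq] at this
  have h2 := abs_add_le (g x - g 0) (g 0)
  rw [sub_add_cancel] at h2
  exact h2.trans (by gcongr)

section

variable {F g : ℝ → ℝ}

theorem integrable_conv (hF : Integrable F) (hg : Integrable g) :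
    Integrable (fun x => ∫ u, F (x - u) * g u) ∧
      eLpNorm (fun x => ∫ u, F (x - u) * g u) 1 volume ≤
        eLpNorm F 1 volume * eLpNorm g 1 volume := by
  have hi : Integrable (fun p : ℝ × ℝ => F (p.1 - p.2) * g p.2) (volume.prod volume) := by
    simpa [mul_comm] using hg.convolution_integrand (ContinuousLinearMap.mul ℝ ℝ) hF
  refine ⟨hi.integral_prod_left, ?_⟩
  simp only [eLpNorm_one_eq_lintegral_enorm]
  calc ∫⁻ x, ‖∫ u, F (x - u) * g u‖ₑ
      ≤ ∫⁻ x, ∫⁻ u, ‖F (x - u) * g u‖ₑ :=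
        lintegral_mono fun x => enorm_integral_le_lintegral_enorm _
    _ = ∫⁻ u, ∫⁻ x, ‖F (x - u) * g u‖ₑ := lintegral_lintegral_swap hi.1.enorm
    _ = ∫⁻ u, (∫⁻ x, ‖F x‖ₑ) * ‖g u‖ₑ := by
        refine lintegral_congr fun u => ?_
        simp only [enorm_mul]
        rw [lintegral_mul_const' _ _ enorm_ne_top, lintegral_sub_right_eq_self (fun x => ‖F x‖ₑ)]
    _ = _ := lintegral_const_mul'' _ hg.1.enorm

theorem continuous_conv {B : ℝ} (hF : Continuous F) (hB : ∀ x, |F x| ≤ B) (hg : Integrable g) :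
    Continuous (fun x => ∫ u, F (x - u) * g u) := by
  refine continuous_of_dominated (bound := fun u => B * |g u|) (fun x => ?_)
    (fun x => Eventually.of_forall fun u => ?_) (hg.abs.const_mul B)
    (Eventually.of_forall fun u => by fun_prop)
  · exact (Continuous.aestronglyMeasurable (by fun_prop)).mul hg.1
  · rw [norm_mul]
    exact mul_le_mul_of_nonneg_right (hB _) (norm_nonneg _)

/-- The integral over `x ∈ S` of a convolution is an integral against the integrals of `g`
over the translates of `S`. -/
theorem setIntegral_conv (hF : Integrable F) (hg : Integrable g) (S : Set ℝ) :
    ∫ x in S, ∫ u, F (x - u) * g u = ∫ u, F u * ∫ x in S, g (x - u) := by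
  have hi : Integrable (fun p : ℝ × ℝ => F p.2 * g (p.1 - p.2)) (volume.prod volume) :=
    hF.convolution_integrand (ContinuousLinearMap.mul ℝ ℝ) hg
  have hi' : Integrable (fun p : ℝ × ℝ => F p.2 * g (p.1 - p.2))
      ((volume.restrict S).prod volume) := by
    refine hi.mono_measure ?_
    exact Measure.prod_mono Measure.restrict_le_self le_rfl
  calc ∫ x in S, ∫ u, F (x - u) * g u = ∫ x in S, ∫ u, F u * g (x - u) := by
        refine integral_congr_ae (Eventually.of_forall fun x => ?_)
        simpa using integral_sub_left_eq_self (fun u => F u * g (x - u)) volume x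
    _ = ∫ u, ∫ x in S, F u * g (x - u) := integral_integral_swap hi'
    _ = _ := by simp only [integral_const_mul]

theorem setIntegral_Iic_conv (hF : Integrable F) (hg : Integrable g) (t : ℝ) :
    ∫ x in Iic t, ∫ u, F (x - u) * g u = ∫ y, F (t - y) * ∫ u in Iic y, g u := by
  rw [setIntegral_conv hF hg]
  have h1 : ∀ u, ∫ x in Iic t, g (x - u) = ∫ x in Iic (t - u), g x := by
    intro u
    have h2 := integral_sub_right_eq_self (μ := volume) ((Iic (t - u)).indicator g) u
    rw [integral_indicator measurableSet_Iic] at h2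
    rw [← h2, ← integral_indicator measurableSet_Iic]
    congr 1
    ext x
    simp [indicator]
  simp only [h1]
  simpa using (integral_sub_left_eq_self (fun u => F u * ∫ x in Iic (t - u), g x) volume t).symm

theorem integral_conv (hF : Integrable F) (hg : Integrable g) :
    ∫ x, ∫ u, F (x - u) * g u = (∫ u, F u) * ∫ x, g x := by
  have h := setIntegral_conv hF hg univ
  simp only [setIntegral_univ, integral_sub_right_eq_self] at h
  rw [h, integral_mul_const]

/-- The convolution with a primitive, integrated by parts. -/
theorem IsLaplacePrimitive.convolution_parts {f : ℝ → ℝ} {B M : ℝ} (hP : IsLaplacePrimitive f F)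
    (hb : Tendsto F atBot (𝓝 0)) (ht : Tendsto F atTop (𝓝 0)) (hB : ∀ x, |F x| ≤ B)
    (hg : Integrable g) (hM : ∀ x, |g x| ≤ M)
    (hGt : Tendsto (fun y => ∫ u in Iic y, g u) atTop (𝓝 0)) (x : ℝ) :
    LaplaceIntegrable (fun y => f (x - y) * ∫ u in Iic y, g u) ∧
      laplaceIntegral (fun y => f (x - y) * ∫ u in Iic y, g u) = ∫ u, F (x - u) * g u := by
  have hQ := (hP.comp_sub_left x).mul_integral (B := B) (fun y => by simpa using hB (x - y)) hg hM
  have hi : Integrable (fun u => -F (x - u) * g u) :=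
    hg.bdd_mul (hP.comp_sub_left x).continuous.aestronglyMeasurable
      (Eventually.of_forall fun y => by simpa using hB (x - y))
  have h1 : Tendsto (fun y : ℝ => -F (x - y)) atBot (𝓝 0) := by
    simpa [sub_eq_add_neg] using (ht.comp (tendsto_const_nhds.add_atTop tendsto_neg_atBot_atTop :
      Tendsto (fun y : ℝ => x + -y) atBot atTop)).neg
  have h2 : Tendsto (fun y : ℝ => -F (x - y)) atTop (𝓝 0) := by
    simpa [sub_eq_add_neg] using (hb.comp (tendsto_const_nhds.add_atBot tendsto_neg_atTop_atBot :
      Tendsto (fun y : ℝ => x + -y) atTop atBot)).neg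
  have h3 := (h1.mul (tendsto_integral_Iic_atBot hg)).sub (tendsto_integral_Iic_atBot hi)
  have h4 := (h2.mul hGt).sub (tendsto_integral_Iic_atTop hi)
  refine ⟨hQ.laplaceIntegrable h3 h4, (hQ.laplaceIntegral_eq h3 h4).trans ?_⟩
  simp [integral_neg]

end

theorem mainTheorem7 (f g F G : ℝ → ℝ)
    (hf : LaplaceIntegrable f)
    (hg : Integrable g volume) (hgBV : BoundedVariationOn g Set.univ)
    (hF : ∀ x, F x = laplaceIntegralIic f x)
    (hG : ∀ x, G x = ∫ u in Set.Iic x, g u)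
    (hFint : Integrable F volume) (hGint : Integrable G volume)
    (hGtop : Tendsto G atTop (𝓝 0)) :
    -- all the integrals that occur below exist
    (∀ x, LaplaceIntegrable (fun y => f (x - y) * G y)) ∧
    (∀ t, LaplaceIntegrableIic (laplaceConv f G) t) ∧
    (∀ t y, LaplaceIntegrableIic (fun x => f (x - y) * G y) t) ∧
    (∀ t, LaplaceIntegrable (fun y => laplaceIntegralIic (fun x => f (x - y) * G y) t)) ∧
    LaplaceIntegrable (laplaceConv f G) ∧
    (∀ y, LaplaceIntegrable (fun x => f (x - y) * G y)) ∧
    LaplaceIntegrable (fun y => laplaceIntegral (fun x => f (x - y) * G y)) ∧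
    -- interchange of the iterated integrals, for real `t` and for `t = ∞`
    (∀ t, laplaceIntegralIic (fun x => laplaceIntegral (fun y => f (x - y) * G y)) t =
      laplaceIntegral (fun y => laplaceIntegralIic (fun x => f (x - y) * G y) t)) ∧
    laplaceIntegral (fun x => laplaceIntegral (fun y => f (x - y) * G y)) =
      laplaceIntegral (fun y => laplaceIntegral (fun x => f (x - y) * G y)) ∧
    -- the two norm estimates, whose members are finite
    Integrable (laplaceConv f G) volume ∧
    eLpNorm (laplaceConv f G) 1 volume ≤ eLpNorm F 1 volume * eLpNorm g 1 volume ∧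
    alexiewiczNorm f < ⊤ ∧
    alexiewiczNorm (laplaceConv f G) ≤ alexiewiczNorm f * eLpNorm G 1 volume := by
  obtain rfl : F = laplaceIntegralIic f := funext hF
  obtain rfl : G = fun x => ∫ u in Iic x, g u := funext hG
  clear hF hG
  set F := laplaceIntegralIic f with hFdef
  set G : ℝ → ℝ := fun x => ∫ u in Iic x, g u with hGdef
  obtain ⟨hP, hb, l, ht⟩ := hf.isLaplacePrimitive_integralIic
  rw [← hFdef] at hP hb ht
  obtain rfl := hFint.eq_zero_of_tendsto_atTop ht
  have hFc := hP.continuous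
  obtain ⟨B, hB⟩ := exists_abs_le_of_tendsto_zero hFc hb ht
  obtain ⟨M, hM⟩ := hgBV.exists_abs_le
  have hparts := hP.convolution_parts hb ht hB hg hM hGtop
  have hGb : Tendsto G atBot (𝓝 0) := tendsto_integral_Iic_atBot hg
  have hg0 : ∫ u, g u = 0 := tendsto_nhds_unique (tendsto_integral_Iic_atTop hg) hGtop
  have hGc : Continuous G := continuous_integral_Iic hg
  -- the convolution
  have hconv : laplaceConv f G = fun x => ∫ u, F (x - u) * g u := funext fun x => (hparts x).2
  have hci := integrable_conv hFint hg
  have hcP := (continuous_conv hFc hB hg).isLaplacePrimitive hci.1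
  rw [← hconv] at hci hcP
  have hcb := tendsto_integral_Iic_atBot hci.1
  have hct := tendsto_integral_Iic_atTop hci.1
  have hcI : ∀ t, laplaceIntegralIic (laplaceConv f G) t = ∫ y, F (t - y) * G y := by
    intro t
    rw [hcP.laplaceIntegralIic_eq hcb, sub_zero, hconv, setIntegral_Iic_conv hFint hg]
  -- the inner integrals with respect to the first variable
  have hxP : ∀ y, IsLaplacePrimitive (fun x => f (x - y) * G y) (fun x => F (x - y) * G y) := by
    intro y
    simpa only [mul_comm] using (hP.comp_sub_right y).const_mul (G y)
  have hxb : ∀ y, Tendsto (fun x => F (x - y) * G y) atBot (𝓝 0) := fun y => by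
    simpa [sub_eq_add_neg] using
      (hb.comp (tendsto_atBot_add_const_right _ (-y) tendsto_id)).mul_const (G y)
  have hxt : ∀ y, Tendsto (fun x => F (x - y) * G y) atTop (𝓝 0) := fun y => by
    simpa [sub_eq_add_neg] using
      (ht.comp (tendsto_atTop_add_const_right _ (-y) tendsto_id)).mul_const (G y)
  have hxI : ∀ t, (fun y => laplaceIntegralIic (fun x => f (x - y) * G y) t) =
      fun y => F (t - y) * G y := fun t => funext fun y => by
    rw [(hxP y).laplaceIntegralIic_eq (hxb y), sub_zero]
  have hxI' : (fun y => laplaceIntegral (fun x => f (x - y) * G y)) = fun _ => (0 : ℝ) :=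
    funext fun y => by rw [(hxP y).laplaceIntegral_eq (hxb y) (hxt y), sub_zero]
  -- the outer integrals with respect to the second variable
  have hyi : ∀ t, Integrable (fun y => F (t - y) * G y) := fun t =>
    hGint.bdd_mul (Continuous.aestronglyMeasurable (by fun_prop))
      (Eventually.of_forall fun y => hB (t - y))
  have hyP : ∀ t, IsLaplacePrimitive (fun y => F (t - y) * G y) _ := fun t =>
    Continuous.isLaplacePrimitive (by fun_prop) (hyi t)
  have hyb := fun t => tendsto_integral_Iic_atBot (hyi t)
  have hyt := fun t => tendsto_integral_Iic_atTop (hyi t)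
  have h0P : IsLaplacePrimitive (fun _ => 0) _ :=
    continuous_const.isLaplacePrimitive (integrable_zero ℝ ℝ volume)
  have h0b := tendsto_integral_Iic_atBot (integrable_zero ℝ ℝ volume)
  have h0t := tendsto_integral_Iic_atTop (integrable_zero ℝ ℝ volume)
  refine ⟨fun x => (hparts x).1, hcP.laplaceIntegrableIic hcb,
    fun t y => (hxP y).laplaceIntegrableIic (hxb y) t, fun t => ?_,
    hcP.laplaceIntegrable hcb hct, fun y => (hxP y).laplaceIntegrable (hxb y) (hxt y), ?_,
    fun t => ?_, ?_, hci.1, hci.2, ?_, ?_⟩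
  · rw [hxI]
    exact (hyP t).laplaceIntegrable (hyb t) (hyt t)
  · rw [hxI']
    exact h0P.laplaceIntegrable h0b h0t
  · rw [hxI, (hyP t).laplaceIntegral_eq (hyb t) (hyt t), sub_zero]
    exact hcI t
  · rw [hxI', h0P.laplaceIntegral_eq h0b h0t]
    refine (hcP.laplaceIntegral_eq hcb hct).trans ?_
    rw [hconv, integral_conv hFint hg, hg0]
    simp
  · exact (iSup_le fun x => ENNReal.ofReal_le_ofReal (hB x)).trans_lt ENNReal.ofReal_lt_top
  · refine iSup_le fun x => ?_
    have hle : ∀ y, ‖F y‖ₑ ≤ alexiewiczNorm f := fun y => by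
      rw [Real.enorm_eq_ofReal_abs]
      exact le_iSup (fun x => ENNReal.ofReal |laplaceIntegralIic f x|) y
    rw [hcI, ← Real.enorm_eq_ofReal_abs, eLpNorm_one_eq_lintegral_enorm,
      ← lintegral_const_mul'' _ hGint.1.enorm]
    refine (enorm_integral_le_lintegral_enorm _).trans (lintegral_mono fun y => ?_)
    rw [enorm_mul]
    gcongr
    exact hle _
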